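/- Let $M$ be an $N$-dimensional Frobenius manifold, i.e. a real smooth manifold with a flat pseudo-Riemannian metric $g$ and a smooth family of commutative associative multiplications $\circ$ on the tangent spaces such that $g(X\circ Y,Z)=g(X,Y\circ Z)$ and such that, for $c(X,Y,Z)=g(X\circ Y,Z)$, the tensor $\nabla c$ is symmetric in its four arguments ($\nabla$ is the Levi-Civita connection of $g$). (Equivalently, near every point there are flat coordinates $u^1,\dots,u^N$, $g=\eta_{ij}\,du^i du^j$ with constant $\eta_{ij}$, and a smooth solution $\Phi$ of the associativity equations with $\partial_i\circ\partial_j=\eta^{ks}\frac{\partial^3\Phi}{\partial u^s\partial u^i\partial u^j}\,\partial_k$; no unity and no Euler vector field are required.) A representation of a coordinate domain $U\subset M$ as a potential flat torsionless submanifold of a $2N$-dimensional pseudo-Euclidean space $E$ consists of a smooth map $r:U\to E$ of rank $N$, flat coordinates $u^1,\dots,u^N$ of $g$ on $U$, smooth normal fields $n_1,\dots,n_N$ along $r$, and a smooth function $\Phi$ on $U$ such that (a) the first fundamental form of $r$ is $g$; (b) $(n_\alpha,\partial_i r)=0$, the Gram matrix $\mu_{\alpha\beta}=(n_\alpha,n_\beta)$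 is constant and nondegenerate, and the torsion coefficients $(\partial_i n_\alpha,n_\beta)$ vanish; (c) in the coordinates $u$ the second fundamental forms $(\omega_i)_{jk}=(n_i,\partial_j\partial_k r)$ are $(\omega_i)_{jk}=\partial_i\partial_j\partial_k\Phi$ (in arbitrary coordinates, $(\omega_i)_{jk}=\nabla_i\nabla_j\nabla_k\Phi$, where the index $i$ transforms as a covector index), and they give the multiplication: $\partial_i\circ\partial_j=g^{ks}(\omega_i)_{sj}\,\partial_k$. Then: 1. (Existence.) For every constant $\kappa\neq 0$, every point of $M$ lies in a connected coordinate domain $U$ that has such a representation in some $2N$-dimensional pseudo-Euclidean space, with $r$ an embedding and with $\mu_{\alpha\beta}=\kappa\,\eta_{\alpha\beta}$, where $\eta_{\alpha\beta}$ is the constant matrix of $g$ in the coordinates $u$. 2. (Uniqueness up to motions.) Let two such representations $r_1,r_2$ of the same connected coordinate domain $U$, in $2N$-dimensional pseudo-Euclidean spaces, have the same Gram tensor of the normals, $\mu^{(1)}_{\alpha\beta}\,du_1^\alpha du_1^\beta=\mu^{(2)}_{\alpha\beta}\,du_2^\alpha du_2^\beta$ (for instance, both equal to $\kappa g$ with the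 same $\kappa$). Then the two spaces have the same signature, and $r_2=T\circ r_1$ on $U$ for a motion (affine isometry) $T$. -/

import Mathlib

open scoped Manifold ContDiff

noncomputable section

namespace FrobeniusSubmanifold

/-! ### Local coordinates: partial derivatives, Levi-Civita connection, curvature -/

/-- The coordinate space with coordinates `(x⁰, …, x^{N-1})`. -/
abbrev Coord (N : ℕ) : Type := EuclideanSpace ℝ (Fin N)

/-- The `i`-th standard coordinate vector. -/
def basisVec {N : ℕ} (i : Fin N) : Coord N := EuclideanSpace.single i 1

/-- The partial derivative `∂f/∂xⁱ`. -/
def pd {N : ℕ} {F : Type*} [NormedAddCommGroup F] [NormedSpace ℝ F]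
    (i : Fin N) (f : Coord N → F) (x : Coord N) : F :=
  fderiv ℝ f x (basisVec i)

/-- The Christoffel symbols `Γᵏᵢⱼ` of the Levi-Civita connection of the metric `g`. -/
def christoffel {N : ℕ} (g : Coord N → Matrix (Fin N) (Fin N) ℝ)
    (k i j : Fin N) (x : Coord N) : ℝ :=
  (1 / 2 : ℝ) * ∑ l, (g x)⁻¹ k l *
    (pd i (fun y => g y l j) x + pd j (fun y => g y l i) x - pd l (fun y => g y i j) x)

/-- The Riemannian curvature `Rˡₖᵢⱼ` of the metric `g`. -/
def curvature {N : ℕ} (g : Coord N → Matrix (Fin N) (Fin N) ℝ)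
    (l k i j : Fin N) (x : Coord N) : ℝ :=
  pd i (christoffel g l j k) x - pd j (christoffel g l i k) x +
    ∑ m, (christoffel g l i m x * christoffel g m j k x -
      christoffel g l j m x * christoffel g m i k x)

/-- The metric `g` is flat on `V`: its Riemannian curvature vanishes. -/
def IsFlatOn {N : ℕ} (g : Coord N → Matrix (Fin N) (Fin N) ℝ) (V : Set (Coord N)) : Prop :=
  ∀ x ∈ V, ∀ l k i j, curvature g l k i j x = 0

/-- The second covariant derivative `∇ᵢ∇ⱼ Φ` of a function. -/
def covHess {N : ℕ} (g : Coord N → Matrix (Fin N) (Fin N) ℝ) (Φ : Coord N → ℝ)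
    (i j : Fin N) (x : Coord N) : ℝ :=
  pd i (pd j Φ) x - ∑ m, christoffel g m i j x * pd m Φ x

/-- The third covariant derivative `∇ᵢ∇ⱼ∇ₖ Φ` of a function. -/
def covThird {N : ℕ} (g : Coord N → Matrix (Fin N) (Fin N) ℝ) (Φ : Coord N → ℝ)
    (i j k : Fin N) (x : Coord N) : ℝ :=
  pd i (covHess g Φ j k) x -
    ∑ m, (christoffel g m i j x * covHess g Φ m k x + christoffel g m i k x * covHess g Φ j m x)

/-- The covariant derivative `∇ₗ cᵢⱼₖ` of a covariant tensor field of rank three. -/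
def covDeriv₃ {N : ℕ} (g : Coord N → Matrix (Fin N) (Fin N) ℝ)
    (c : Fin N → Fin N → Fin N → Coord N → ℝ) (l i j k : Fin N) (x : Coord N) : ℝ :=
  pd l (c i j k) x -
    ∑ m, (christoffel g m l i x * c m j k x + christoffel g m l j x * c i m k x +
      christoffel g m l k x * c i j m x)

/-! ### Frobenius manifolds -/

section Manifold

variable {N : ℕ} {M : Type*} [TopologicalSpace M] [ChartedSpace (Coord N) M]

/-- The coordinate vector field `∂/∂xⁱ` of the chart `χ`, at the point with coordinates `x`. -/
def coordVec (χ : OpenPartialHomeomorph M (Coord N)) (i : Fin N) (x : Coord N) :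
    TangentSpace (𝓡 N) (χ.symm x) :=
  mfderiv (𝓡 N) (𝓡 N) χ.symm x (basisVec i)

/-- The components `gᵢⱼ` in the chart `χ` of a field `g` of bilinear forms on `M`. -/
def metricInChart (g : ∀ p : M, TangentSpace (𝓡 N) p →ₗ[ℝ] TangentSpace (𝓡 N) p →ₗ[ℝ] ℝ)
    (χ : OpenPartialHomeomorph M (Coord N)) (x : Coord N) : Matrix (Fin N) (Fin N) ℝ :=
  Matrix.of fun i j => g (χ.symm x) (coordVec χ i x) (coordVec χ j x)

/-- The components `cᵢⱼₖ = g(∂ᵢ ∘ ∂ⱼ, ∂ₖ)` in the chart `χ` of a multiplication `∘` on the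
tangent spaces, with the upper index lowered by `g`. -/
def mulInChart (g : ∀ p : M, TangentSpace (𝓡 N) p →ₗ[ℝ] TangentSpace (𝓡 N) p →ₗ[ℝ] ℝ)
    (mul : ∀ p : M, TangentSpace (𝓡 N) p →ₗ[ℝ] TangentSpace (𝓡 N) p →ₗ[ℝ] TangentSpace (𝓡 N) p)
    (χ : OpenPartialHomeomorph M (Coord N)) (i j k : Fin N) (x : Coord N) : ℝ :=
  g (χ.symm x) (mul (χ.symm x) (coordVec χ i x) (coordVec χ j x)) (coordVec χ k x)

end Manifold

/-- An `N`-dimensional Frobenius manifold (no unity and no Euler vector field are required): a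
smooth manifold with a flat pseudo-Riemannian metric and a smooth family of Frobenius algebra
structures on its tangent spaces such that the covariant derivative `∇c` of the tensor
`c(X, Y, Z) = g(X ∘ Y, Z)` is symmetric in its four arguments. (As `c` itself is symmetric, it is
enough to ask for the symmetry in the first two arguments of `∇c`.) Equivalently, near every
point there are flat coordinates in which `cᵢⱼₖ` are the third derivatives of a solution of the
associativity equations. -/
structure FrobeniusManifold (N : ℕ) (M : Type*) [TopologicalSpace M] [ChartedSpace (Coord N) M]
    [IsManifold (𝓡 N) ∞ M] where
  /-- the metric -/
  metric : ∀ p : M, TangentSpace (𝓡 N) p →ₗ[ℝ] TangentSpace (𝓡 N) p →ₗ[ℝ] ℝ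
  /-- the multiplication of tangent vectors -/
  mul : ∀ p : M, TangentSpace (𝓡 N) p →ₗ[ℝ] TangentSpace (𝓡 N) p →ₗ[ℝ] TangentSpace (𝓡 N) p
  metric_symm : ∀ p X Y, metric p X Y = metric p Y X
  metric_nondegenerate : ∀ p X, (∀ Y, metric p X Y = 0) → X = 0
  mul_comm : ∀ p X Y, mul p X Y = mul p Y X
  mul_assoc : ∀ p X Y Z, mul p (mul p X Y) Z = mul p X (mul p Y Z)
  invariant : ∀ p X Y Z, metric p (mul p X Y) Z = metric p X (mul p Y Z)
  metric_smooth : ∀ χ ∈ atlas (Coord N) M, ∀ i j,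
    ContDiffOn ℝ ∞ (fun x => metricInChart metric χ x i j) χ.target
  mul_smooth : ∀ χ ∈ atlas (Coord N) M, ∀ i j k,
    ContDiffOn ℝ ∞ (mulInChart metric mul χ i j k) χ.target
  flat : ∀ χ ∈ atlas (Coord N) M, IsFlatOn (metricInChart metric χ) χ.target
  potential : ∀ χ ∈ atlas (Coord N) M, ∀ x ∈ χ.target, ∀ l i j k,
    covDeriv₃ (metricInChart metric χ) (mulInChart metric mul χ) l i j k x =
      covDeriv₃ (metricInChart metric χ) (mulInChart metric mul χ) i l j k x

/-! ### Submanifolds of pseudo-Euclidean spaces -/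

/-- The scalar product of the `m`-dimensional pseudo-Euclidean space of index `s`:
`-x₁y₁ - … - xₛyₛ + xₛ₊₁yₛ₊₁ + … + xₘyₘ`. -/
def pseudoInner {m : ℕ} (s : ℕ) (x y : EuclideanSpace ℝ (Fin m)) : ℝ :=
  ∑ a : Fin m, (if (a : ℕ) < s then (-1 : ℝ) else 1) * x a * y a

/-- Motions (affine isometries) of the `m`-dimensional pseudo-Euclidean space of index `s`. -/
def IsMotion {m : ℕ} (s : ℕ) (T : EuclideanSpace ℝ (Fin m) → EuclideanSpace ℝ (Fin m)) : Prop :=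
  ∃ (A : EuclideanSpace ℝ (Fin m) →ₗ[ℝ] EuclideanSpace ℝ (Fin m)) (b : EuclideanSpace ℝ (Fin m)),
    (∀ v w, pseudoInner s (A v) (A w) = pseudoInner s v w) ∧ ∀ x, T x = A x + b

/-- The first fundamental form `gᵢⱼ = (∂ᵢr, ∂ⱼr)`. -/
def firstForm {N m : ℕ} (s : ℕ) (r : Coord N → EuclideanSpace ℝ (Fin m)) (x : Coord N) :
    Matrix (Fin N) (Fin N) ℝ :=
  Matrix.of fun i j => pseudoInner s (pd i r x) (pd j r x)

/-- The second fundamental form `ωⱼₖ = (n, ∂ⱼ∂ₖr)` with respect to a normal field `n`. -/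
def secondForm {N m : ℕ} (s : ℕ) (r n : Coord N → EuclideanSpace ℝ (Fin m)) (j k : Fin N)
    (x : Coord N) : ℝ :=
  pseudoInner s (n x) (pd j (pd k r) x)

/-- The smooth vector function `r`, on the open set `V`, parametrizes a totally nonisotropic
`N`-dimensional submanifold of the `m`-dimensional pseudo-Euclidean space of index `s`. -/
structure IsSubmanifoldOn {N m : ℕ} (s : ℕ) (V : Set (Coord N))
    (r : Coord N → EuclideanSpace ℝ (Fin m)) : Prop where
  smooth : ContDiffOn ℝ ∞ r V
  rank : ∀ x ∈ V, Function.Injective (fderiv ℝ r x)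
  nonisotropic : ∀ x ∈ V, (firstForm s r x).det ≠ 0

/-- `ν₁, …, ν_L` are normals, with constant nondegenerate Gram matrix `μ`, with respect to which
the torsion coefficients `(∂ᵢν_α, ν_β)` of the submanifold vanish. -/
structure IsTorsionlessFrameOn {N L m : ℕ} (s : ℕ) (V : Set (Coord N))
    (r : Coord N → EuclideanSpace ℝ (Fin m)) (ν : Fin L → Coord N → EuclideanSpace ℝ (Fin m))
    (μ : Matrix (Fin L) (Fin L) ℝ) : Prop where
  smooth : ∀ α, ContDiffOn ℝ ∞ (ν α) V
  normal : ∀ x ∈ V, ∀ α i, pseudoInner s (ν α x) (pd i r x) = 0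
  gram : ∀ x ∈ V, ∀ α β, pseudoInner s (ν α x) (ν β x) = μ α β
  gram_det : μ.det ≠ 0
  torsion : ∀ x ∈ V, ∀ α β i, pseudoInner s (pd i (ν α) x) (ν β x) = 0

/-- `u = (u¹, …, u^N)` is a system of flat coordinates of the metric `g` on `V` (locally: a smooth
map with invertible Jacobian matrix) in which `g` becomes the constant matrix `η`. -/
structure IsFlatCoordOn {N : ℕ} (g : Coord N → Matrix (Fin N) (Fin N) ℝ) (V : Set (Coord N))
    (u : Fin N → Coord N → ℝ) (η : Matrix (Fin N) (Fin N) ℝ) : Prop where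
  smooth : ∀ α, ContDiffOn ℝ ∞ (u α) V
  jacobian : ∀ x ∈ V, (Matrix.of fun α i => pd i (u α) x).det ≠ 0
  metric_eq : ∀ x ∈ V, ∀ i j, g x i j = ∑ α, ∑ β, η α β * pd i (u α) x * pd j (u β) x

/-- The coefficients `(ωᵢ)ⱼₖ = ∑_α (∂u^α/∂xⁱ) ω_{α,jk}`, in the coordinates `x`, of the set of the
second fundamental forms `ω_α` of normals `ν_α` that are numbered by the coordinates `u^α`. If `u`
are the coordinates `x` themselves, these are the second fundamental forms of the `νᵢ`. -/
def secondForms {N m : ℕ} (s : ℕ) (r : Coord N → EuclideanSpace ℝ (Fin m))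
    (ν : Fin N → Coord N → EuclideanSpace ℝ (Fin m)) (u : Fin N → Coord N → ℝ)
    (i j k : Fin N) (x : Coord N) : ℝ :=
  ∑ α, pd i (u α) x * secondForm s r (ν α) j k x

/-- The Gram matrix `∑ μ_{αβ} (∂u^α/∂xⁱ) (∂u^β/∂xʲ)`, in the coordinates `x`, of normals `ν_α` with
Gram matrix `μ` that are numbered by the coordinates `u^α`. -/
def normalGram {N : ℕ} (μ : Matrix (Fin N) (Fin N) ℝ) (u : Fin N → Coord N → ℝ)
    (x : Coord N) : Matrix (Fin N) (Fin N) ℝ :=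
  Matrix.of fun i j => ∑ α, ∑ β, μ α β * pd i (u α) x * pd j (u β) x

/-- On the open set `V`, `r` parametrizes a potential flat torsionless `N`-dimensional submanifold
of the `2N`-dimensional pseudo-Euclidean space of index `s`, with the normals `ν_α` (of Gram matrix
`μ`) numbered by flat coordinates `u^α`: the submanifold is flat, has zero torsion, and for some
function `Φ` its second fundamental forms are `(ωᵢ)ⱼₖ = ∇ᵢ∇ⱼ∇ₖΦ`. -/
structure IsPotentialFlatTorsionlessOn {N : ℕ} (s : ℕ) (V : Set (Coord N))
    (r : Coord N → EuclideanSpace ℝ (Fin (2 * N)))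
    (ν : Fin N → Coord N → EuclideanSpace ℝ (Fin (2 * N))) (μ : Matrix (Fin N) (Fin N) ℝ)
    (u : Fin N → Coord N → ℝ) (η : Matrix (Fin N) (Fin N) ℝ) : Prop where
  submanifold : IsSubmanifoldOn s V r
  flat : IsFlatOn (firstForm s r) V
  torsionless : IsTorsionlessFrameOn s V r ν μ
  flatCoord : IsFlatCoordOn (firstForm s r) V u η
  potential : ∃ Φ : Coord N → ℝ, ContDiffOn ℝ ∞ Φ V ∧
    ∀ x ∈ V, ∀ i j k, secondForms s r ν u i j k x = covThird (firstForm s r) Φ i j k x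

section Representation

variable {N : ℕ} {M : Type*} [TopologicalSpace M] [ChartedSpace (Coord N) M]
  [IsManifold (𝓡 N) ∞ M]

/-- The coordinate domain of the chart `χ` of the Frobenius manifold `F` is represented by `r` as
a potential flat torsionless submanifold of the `2N`-dimensional pseudo-Euclidean space of index
`s`: the first fundamental form is the metric of `F`, and the second fundamental forms give the
structure functions of the multiplication, `∂ᵢ ∘ ∂ⱼ = ∑ₖ (∑ₗ gᵏˡ (ωᵢ)ₗⱼ) ∂ₖ`. -/
structure FrobeniusManifold.IsRepresentedBy (F : FrobeniusManifold N M)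
    (χ : OpenPartialHomeomorph M (Coord N)) (s : ℕ)
    (r : Coord N → EuclideanSpace ℝ (Fin (2 * N)))
    (ν : Fin N → Coord N → EuclideanSpace ℝ (Fin (2 * N))) (μ : Matrix (Fin N) (Fin N) ℝ)
    (u : Fin N → Coord N → ℝ) (η : Matrix (Fin N) (Fin N) ℝ) : Prop where
  potentialSubmanifold : IsPotentialFlatTorsionlessOn s χ.target r ν μ u η
  firstForm_eq : ∀ x ∈ χ.target, firstForm s r x = metricInChart F.metric χ x
  mul_eq : ∀ x ∈ χ.target, ∀ i j,
    F.mul (χ.symm x) (coordVec χ i x) (coordVec χ j x) =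
      ∑ k, (∑ l, (firstForm s r x)⁻¹ k l * secondForms s r ν u i l j x) • coordVec χ k x

end Representation

end FrobeniusSubmanifold

end

/-!
Both halves of the theorem are about the moving frame of the submanifold, and every step is a linear
total differential system `∂ᵢY = AᵢY` for a matrix-valued function `Y`. Such a system with
`∂ᵢAⱼ + AⱼAᵢ` symmetric in `i`, `j` has a solution near `x₀` with any prescribed value at `x₀`
(`exists_solution_matrix_system`). The solution is constructed along the rays from `x₀`, and
Grönwall's inequality, applied to the difference of the solutions on two neighbouring rays and its
expected linear part, shows that the system holds in all directions (`norm_ray_sub_ray_le`);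
smoothness follows by bootstrapping.

*Existence.* In a chart with coordinates `x`, put `Γₗ = (Γᵏₗⱼ)ₖⱼ`. As the curvature vanishes, the
system `∂ₗJ = J Γₗ` is integrable, and its rows are the differentials of flat coordinates `u^α`
(`exists_flat_coordinates`), in which the metric is a constant matrix `η`. Let `Cᵢ` be the matrix of
the `c(∂/∂u^α, ∂/∂u^β, ∂/∂xⁱ)`. The symmetry of `∇c` means that the forms `∑ᵢ Cᵢ dxⁱ` are closed
(`IsFlatFrobeniusOn.pdM_flatMul`), and the associativity of the multiplication means that
`Cᵢ η⁻¹ Cⱼ` is symmetric in `i`, `j` (`IsFlatFrobeniusOn.flatMul_assoc`). By the first property, three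
applications of the Poincaré lemma give `Φ` with `cᵢⱼₖ = ∇ᵢ∇ⱼ∇ₖΦ`
(`IsFlatFrobeniusOn.exists_covThird_eq`). By both properties, the system
`∂ᵢP = κ⁻¹ Cᵢ η⁻¹ Q`, `∂ᵢQ = -Cᵢ η⁻¹ P` for the tangent frame `P` and the normals `Q` is integrable;
its matrix is skew with respect to `diag(η, κη)`, so the Gram matrix `diag(η, κη)` is preserved
(`IsFlatFrobeniusOn.exists_frame`). The Poincaré lemma then gives `r` with `dr = ∑_α P_α du^α`, which
is an immersion, hence locally an embedding (`IsFlatFrobeniusOn.exists_submanifold`).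

*Uniqueness.* The frame `(∂ᵢr, N_i)` with `N_i = ∑_α (∂ᵢu^α) ν_α` spans the whole space. Its Gram
matrix is given by the metric and by the Gram tensor of the normals. The components of its
derivatives with respect to itself are the Christoffel symbols of the first kind of these two tensors
and the second fundamental forms (`pdM_coordFrame`), the latter determined by the multiplication. So
for two representations all these data coincide, the matrix which takes one frame to the other is a
constant isometry (`exists_isometry_of_frames`), and the indices agree by Sylvester's law of inertia.
-/

noncomputable section

namespace FrobeniusSubmanifold

/-! ### Partial derivatives -/

section PartialDerivatives

variable {N : ℕ} {F : Type*} [NormedAddCommGroup F] [NormedSpace ℝ F]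

theorem pd_congr {V : Set (Coord N)} (hV : IsOpen V) {f f' : Coord N → F}
    (h : ∀ y ∈ V, f y = f' y) {x : Coord N} (hx : x ∈ V) (i : Fin N) : pd i f x = pd i f' x := by
  have : f =ᶠ[nhds x] f' := Filter.eventually_of_mem (hV.mem_nhds hx) h
  rw [pd, pd, this.fderiv_eq]

theorem differentiableAt_of_contDiffOn {V : Set (Coord N)} (hV : IsOpen V) {f : Coord N → F}
    (h : ContDiffOn ℝ ∞ f V) {x : Coord N} (hx : x ∈ V) : DifferentiableAt ℝ f x :=
  (h.contDiffAt (hV.mem_nhds hx)).differentiableAt (by simp)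

theorem contDiffOn_pd {V : Set (Coord N)} (hV : IsOpen V) {f : Coord N → F}
    (h : ContDiffOn ℝ ∞ f V) (i : Fin N) : ContDiffOn ℝ ∞ (pd i f) V :=
  (h.fderiv_of_isOpen hV (m := ∞) (by simp)).clm_apply contDiffOn_const

theorem fderiv_apply_eq_sum_pd (f : Coord N → F) (x v : Coord N) :
    fderiv ℝ f x v = ∑ i, v i • pd i f x := by
  have : v = ∑ i, v i • basisVec i := by
    ext j
    simp [basisVec, Finset.sum_apply, Pi.single_apply]
  conv_lhs => rw [this]
  simp [pd]

@[simp] theorem pd_const (i : Fin N) (a : F) (x : Coord N) : pd i (fun _ => a) x = 0 := by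
  simp [pd]

theorem pd_add {f f' : Coord N → F} {x : Coord N} (hf : DifferentiableAt ℝ f x)
    (hf' : DifferentiableAt ℝ f' x) (i : Fin N) :
    pd i (fun y => f y + f' y) x = pd i f x + pd i f' x := by
  simp [pd, fderiv_fun_add hf hf']

theorem pd_sub {f f' : Coord N → F} {x : Coord N} (hf : DifferentiableAt ℝ f x)
    (hf' : DifferentiableAt ℝ f' x) (i : Fin N) :
    pd i (fun y => f y - f' y) x = pd i f x - pd i f' x := by
  simp [pd, fderiv_fun_sub hf hf']

theorem pd_mul {f f' : Coord N → ℝ} {x : Coord N} (hf : DifferentiableAt ℝ f x)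
    (hf' : DifferentiableAt ℝ f' x) (i : Fin N) :
    pd i (fun y => f y * f' y) x = pd i f x * f' x + f x * pd i f' x := by
  simp [pd, fderiv_fun_mul hf hf']
  ring

theorem pd_const_mul {f : Coord N → ℝ} {x : Coord N} (hf : DifferentiableAt ℝ f x) (a : ℝ)
    (i : Fin N) : pd i (fun y => a * f y) x = a * pd i f x := by
  simp [pd, fderiv_const_mul hf]

theorem pd_sum {ι : Type*} [Fintype ι] {f : ι → Coord N → F} {x : Coord N}
    (hf : ∀ a, DifferentiableAt ℝ (f a) x) (i : Fin N) :
    pd i (fun y => ∑ a, f a y) x = ∑ a, pd i (f a) x := by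
  simp [pd, fderiv_fun_sum fun a _ => hf a]

theorem pd_coord {ι : Type*} [Fintype ι] {f : Coord N → EuclideanSpace ℝ ι} {x : Coord N}
    (hf : DifferentiableAt ℝ f x) (i : Fin N) (p : ι) :
    (pd i f x) p = pd i (fun y => f y p) x := by
  have : (fun y => f y p) = (EuclideanSpace.proj p : EuclideanSpace ℝ ι →L[ℝ] ℝ) ∘ f := rfl
  rw [pd, pd, this, ((EuclideanSpace.proj p).hasFDerivAt.comp x hf.hasFDerivAt).fderiv]
  rfl

theorem pd_comm {V : Set (Coord N)} (hV : IsOpen V) {f : Coord N → F}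
    (h : ContDiffOn ℝ ∞ f V) {x : Coord N} (hx : x ∈ V) (i j : Fin N) :
    pd i (pd j f) x = pd j (pd i f) x := by
  have hs : IsSymmSndFDerivAt ℝ f x :=
    (h.contDiffAt (hV.mem_nhds hx)).isSymmSndFDerivAt (by
      rw [minSmoothness_of_isRCLikeNormedField]
      exact WithTop.coe_le_coe.2 le_top)
  have hd : DifferentiableAt ℝ (fderiv ℝ f) x :=
    differentiableAt_of_contDiffOn hV (h.fderiv_of_isOpen hV (m := ∞) (by simp)) hx
  have key : ∀ a b : Fin N, pd a (pd b f) x = fderiv ℝ (fderiv ℝ f) x (basisVec a) (basisVec b) := by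
    intro a b
    have := (hd.hasFDerivAt.clm_apply (hasFDerivAt_const (basisVec b) x)).fderiv
    change fderiv ℝ (fun y => fderiv ℝ f y (basisVec b)) x (basisVec a) = _
    rw [this]
    simp
  rw [key, key]
  exact hs _ _

theorem exists_eq_const_of_pd_eq_zero {V : Set (Coord N)} (hV : IsOpen V) (hc : IsPreconnected V)
    {f : Coord N → F} (h : ContDiffOn ℝ ∞ f V) (h0 : ∀ x ∈ V, ∀ i, pd i f x = 0) :
    ∃ a, ∀ x ∈ V, f x = a := by
  refine hV.exists_is_const_of_fderiv_eq_zero (𝕜 := ℝ) hc (h.differentiableOn (by simp)) ?_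
  intro x hx
  ext1 v
  simp [fderiv_apply_eq_sum_pd, h0 x hx]

/-- A map whose differential at `x` is a smooth function of `x` and of its value is smooth. -/
theorem contDiffOn_of_fderiv_eq {X : Type*} [NormedAddCommGroup X] [NormedSpace ℝ X]
    {V : Set X} (hV : IsOpen V) {f : X → F} {Ω : X → F →L[ℝ] X →L[ℝ] F}
    (hΩ : ContDiffOn ℝ ∞ Ω V) (h : ∀ x ∈ V, HasFDerivAt f (Ω x (f x)) x) :
    ContDiffOn ℝ ∞ f V := by
  have hd : DifferentiableOn ℝ f V := fun x hx => (h x hx).differentiableAt.differentiableWithinAt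
  refine contDiffOn_infty.2 fun n => ?_
  induction n with
  | zero => exact contDiffOn_zero.2 hd.continuousOn
  | succ n ih =>
    rw [show ((n + 1 : ℕ) : WithTop ℕ∞) = (n : WithTop ℕ∞) + 1 by norm_cast,
      contDiffOn_succ_iff_fderiv_of_isOpen hV]
    refine ⟨hd, by simp, ?_⟩
    refine ((hΩ.of_le (by exact_mod_cast le_top)).clm_apply ih).congr fun x hx => ?_
    exact (h x hx).fderiv

/-- The Poincaré lemma in coordinates: on a convex open set, smooth functions `θ₁, …, θ_N` with
`∂ᵢθⱼ = ∂ⱼθᵢ` are the partial derivatives of a smooth function. -/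
theorem exists_potential {V : Set (Coord N)} (hV : IsOpen V) (hc : Convex ℝ V)
    {θ : Fin N → Coord N → ℝ} (hθ : ∀ i, ContDiffOn ℝ ∞ (θ i) V)
    (hcl : ∀ x ∈ V, ∀ i j, pd i (θ j) x = pd j (θ i) x) :
    ∃ f : Coord N → ℝ, ContDiffOn ℝ ∞ f V ∧ ∀ x ∈ V, ∀ i, pd i f x = θ i x := by
  let T : Fin N → Coord N →L[ℝ] ℝ := fun i => EuclideanSpace.proj i
  let w : Coord N → Coord N →L[ℝ] ℝ := fun x => ∑ i, θ i x • T i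
  have hw : ContDiffOn ℝ ∞ w V := ContDiffOn.sum fun i _ => (hθ i).smul contDiffOn_const
  have hwd : ∀ x ∈ V, HasFDerivAt w (∑ i, (fderiv ℝ (θ i) x).smulRight (T i)) x := fun x hx =>
    HasFDerivAt.fun_sum fun i _ =>
      (differentiableAt_of_contDiffOn hV (hθ i) hx).hasFDerivAt.smul_const (T i)
  obtain ⟨f, hf⟩ := hc.exists_forall_hasFDerivAt_of_fderiv_symmetric hV
    (hw.differentiableOn (by simp)) (by
      intro a ha x y
      rw [(hwd a ha).fderiv]
      simp only [sum_apply, ContinuousLinearMap.smulRight_apply,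
        smul_apply, fderiv_apply_eq_sum_pd, smul_eq_mul, Finset.sum_mul]
      rw [Finset.sum_comm]
      refine Finset.sum_congr rfl fun i _ => Finset.sum_congr rfl fun j _ => ?_
      rw [hcl a ha i j]
      change x i * pd j (θ i) a * y j = y j * pd j (θ i) a * x i
      ring)
  refine ⟨f, ?_, fun x hx i => ?_⟩
  · rw [contDiffOn_infty_iff_fderiv_of_isOpen hV]
    exact ⟨fun x hx => (hf x hx).differentiableAt.differentiableWithinAt,
      hw.congr fun x hx => (hf x hx).fderiv⟩
  · rw [pd, (hf x hx).fderiv]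
    simp [w, T, basisVec]

end PartialDerivatives

/-! ### Matrix-valued functions -/

section MatrixCalculus

open Matrix

variable {N : ℕ} {m n p : Type*}

/-- The entrywise partial derivative of a matrix-valued function. -/
def pdM (i : Fin N) (M : Coord N → Matrix m n ℝ) (x : Coord N) : Matrix m n ℝ :=
  Matrix.of fun a b => pd i (fun y => M y a b) x

/-- Entrywise smoothness of a matrix-valued function. -/
def SmoothMatOn (M : Coord N → Matrix m n ℝ) (V : Set (Coord N)) : Prop :=
  ∀ a b, ContDiffOn ℝ ∞ (fun y => M y a b) V

variable {V : Set (Coord N)} {L M : Coord N → Matrix m n ℝ} {x : Coord N}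

@[simp] theorem pdM_apply (i : Fin N) (M : Coord N → Matrix m n ℝ) (x : Coord N) (a : m) (b : n) :
    pdM i M x a b = pd i (fun y => M y a b) x := rfl

theorem pdM_congr (hV : IsOpen V) (h : ∀ y ∈ V, L y = M y) (hx : x ∈ V) (i : Fin N) :
    pdM i L x = pdM i M x := by
  ext a b
  exact pd_congr hV (fun y hy => by rw [h y hy]) hx i

theorem pdM_const (i : Fin N) (A : Matrix m n ℝ) (x : Coord N) : pdM i (fun _ => A) x = 0 := by
  ext a b
  simp

theorem pdM_transpose (i : Fin N) (M : Coord N → Matrix m n ℝ) (x : Coord N) :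
    pdM i (fun y => (M y)ᵀ) x = (pdM i M x)ᵀ := rfl

theorem SmoothMatOn.const (A : Matrix m n ℝ) : SmoothMatOn (fun _ => A) V :=
  fun _ _ => contDiffOn_const

theorem SmoothMatOn.congr (hM : SmoothMatOn M V) (h : ∀ y ∈ V, L y = M y) : SmoothMatOn L V :=
  fun a b => (hM a b).congr fun y hy => by rw [h y hy]

theorem SmoothMatOn.mono {U : Set (Coord N)} (hM : SmoothMatOn M V) (h : U ⊆ V) :
    SmoothMatOn M U := fun a b => (hM a b).mono h

theorem SmoothMatOn.transpose (hM : SmoothMatOn M V) : SmoothMatOn (fun y => (M y)ᵀ) V :=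
  fun a b => hM b a

theorem SmoothMatOn.smul (hM : SmoothMatOn M V) (c : ℝ) : SmoothMatOn (fun y => c • M y) V :=
  fun a b => contDiffOn_const.mul (hM a b)

theorem SmoothMatOn.neg (hM : SmoothMatOn M V) : SmoothMatOn (fun y => -M y) V :=
  fun a b => (hM a b).neg

theorem SmoothMatOn.mul [Fintype n] {P : Coord N → Matrix n p ℝ} (hM : SmoothMatOn M V)
    (hP : SmoothMatOn P V) : SmoothMatOn (fun y => M y * P y) V := by
  intro a b
  simp only [Matrix.mul_apply]
  exact ContDiffOn.sum fun i _ => (hM a i).mul (hP i b)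

theorem SmoothMatOn.fromBlocks {m' n' : Type*} {A : Coord N → Matrix m n ℝ}
    {B : Coord N → Matrix m n' ℝ} {C : Coord N → Matrix m' n ℝ} {D : Coord N → Matrix m' n' ℝ}
    (hA : SmoothMatOn A V) (hB : SmoothMatOn B V) (hC : SmoothMatOn C V) (hD : SmoothMatOn D V) :
    SmoothMatOn (fun y => Matrix.fromBlocks (A y) (B y) (C y) (D y)) V := by
  rintro (a | a) (b | b)
  · exact hA a b
  · exact hB a b
  · exact hC a b
  · exact hD a b

theorem SmoothMatOn.det [Fintype n] [DecidableEq n] {M : Coord N → Matrix n n ℝ}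
    (hM : SmoothMatOn M V) : ContDiffOn ℝ ∞ (fun y => (M y).det) V := by
  simp only [Matrix.det_apply']
  exact ContDiffOn.sum fun σ _ => contDiffOn_const.mul (contDiffOn_prod fun i _ => hM _ _)

theorem SmoothMatOn.inv [Fintype n] [DecidableEq n] {M : Coord N → Matrix n n ℝ}
    (hM : SmoothMatOn M V) (h : ∀ y ∈ V, (M y).det ≠ 0) : SmoothMatOn (fun y => (M y)⁻¹) V := by
  intro a b
  have : ∀ y, (M y)⁻¹ a b = ((M y).det)⁻¹ * ((M y).updateRow b (Pi.single a 1)).det := by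
    intro y
    rw [Matrix.inv_def, Matrix.smul_apply, Matrix.adjugate_apply, Ring.inverse_eq_inv', smul_eq_mul]
  simp only [this]
  refine (hM.det.inv h).mul (SmoothMatOn.det fun c d => ?_)
  by_cases hc : c = b
  · subst hc
    simpa using contDiffOn_const
  · simpa [Matrix.updateRow_ne hc] using hM c d

theorem SmoothMatOn.pdM (hV : IsOpen V) (hM : SmoothMatOn M V) (i : Fin N) :
    SmoothMatOn (pdM i M) V := fun a b => contDiffOn_pd hV (hM a b) i

theorem SmoothMatOn.differentiableAt (hM : SmoothMatOn M V) (hV : IsOpen V) (hx : x ∈ V) (a : m)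
    (b : n) : DifferentiableAt ℝ (fun y => M y a b) x :=
  differentiableAt_of_contDiffOn hV (hM a b) hx

theorem pdM_smul (hV : IsOpen V) (hM : SmoothMatOn M V) (hx : x ∈ V) (c : ℝ)
    (i : Fin N) : pdM i (fun y => c • M y) x = c • pdM i M x := by
  ext a b
  exact pd_const_mul (hM.differentiableAt hV hx a b) c i

/-- The Leibniz rule for the product of matrices. -/
theorem pdM_mul [Fintype n] {P : Coord N → Matrix n p ℝ} (hV : IsOpen V) (hM : SmoothMatOn M V)
    (hP : SmoothMatOn P V) (hx : x ∈ V) (i : Fin N) :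
    pdM i (fun y => M y * P y) x = pdM i M x * P x + M x * pdM i P x := by
  ext a b
  simp only [pdM_apply, Matrix.add_apply, Matrix.mul_apply]
  rw [pd_sum fun c => (hM.differentiableAt hV hx a c).fun_mul (hP.differentiableAt hV hx c b),
    ← Finset.sum_add_distrib]
  exact Finset.sum_congr rfl fun c _ =>
    pd_mul (hM.differentiableAt hV hx a c) (hP.differentiableAt hV hx c b) i

theorem pdM_mul_const [Fintype n] (hV : IsOpen V) (hM : SmoothMatOn M V) (hx : x ∈ V)
    (A : Matrix n p ℝ) (i : Fin N) : pdM i (fun y => M y * A) x = pdM i M x * A := by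
  rw [pdM_mul hV hM (.const A) hx, pdM_const, Matrix.mul_zero, add_zero]

/-- The derivative of the inverse `P` of a matrix `M`, whose rows and columns may be indexed by
different types. -/
theorem pdM_of_mul_eq_one [Fintype n] [Fintype m] [DecidableEq n] [DecidableEq m]
    {P : Coord N → Matrix n m ℝ} (hV : IsOpen V)
    (hM : SmoothMatOn M V) (hP : SmoothMatOn P V) (hPM : ∀ y ∈ V, P y * M y = 1)
    (hMP : ∀ y ∈ V, M y * P y = 1) (hx : x ∈ V) (i : Fin N) :
    pdM i P x = -(P x * pdM i M x * P x) := by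
  have h : pdM i P x * M x + P x * pdM i M x = 0 := by
    rw [← pdM_mul hV hP hM hx, pdM_congr hV hPM hx, pdM_const]
  have h' := congrArg (· * P x) h
  simp only [Matrix.add_mul, Matrix.mul_assoc, hMP x hx, Matrix.mul_one, Matrix.zero_mul] at h'
  rw [eq_neg_of_add_eq_zero_left h', Matrix.mul_assoc]

theorem exists_eq_const_of_pdM_eq_zero (hV : IsOpen V) (hc : IsPreconnected V)
    (hM : SmoothMatOn M V) (h0 : ∀ y ∈ V, ∀ i, pdM i M y = 0) : ∃ A, ∀ y ∈ V, M y = A := by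
  have : ∀ a b, ∃ c, ∀ y ∈ V, M y a b = c := fun a b =>
    exists_eq_const_of_pd_eq_zero hV hc (hM a b) fun y hy i => congrFun (congrFun (h0 y hy i) a) b
  choose A hA using this
  exact ⟨A, fun y hy => by ext a b; exact hA a b y hy⟩

end MatrixCalculus

/-! ### Linear total differential systems -/

section TotalSystem

set_option maxSynthPendingDepth 3

open Set Metric

theorem eventually_norm_le_add_one {X E : Type*} [TopologicalSpace X] [NormedAddCommGroup E] {x₀ : X} {f : X → E}
    (hf : ContinuousAt f x₀) : ∀ᶠ x in nhds x₀, ‖f x‖ ≤ ‖f x₀‖ + 1 :=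
  (hf.norm.eventually_lt continuousAt_const (lt_add_one _)).mono fun _ h => h.le

variable {X W : Type*} [NormedAddCommGroup X] [NormedSpace ℝ X] [NormedAddCommGroup W]
  [NormedSpace ℝ W]

/-- A linear equation `Y' = A(t) Y` with a small coefficient is solvable on the whole of `[0, 1]`,
with an a priori bound on the solution. -/
theorem exists_solution_linear_ode [CompleteSpace W] {A : ℝ → W →L[ℝ] W}
    (hA : ContinuousOn A (Icc 0 1)) (hb : ∀ t ∈ Icc (0 : ℝ) 1, ‖A t‖ ≤ 1 / 2) (Y₀ : W) :
    ∃ Y : ℝ → W, Y 0 = Y₀ ∧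
      (∀ t ∈ Icc (0 : ℝ) 1, HasDerivWithinAt Y (A t (Y t)) (Icc 0 1) t) ∧
      ∀ t ∈ Icc (0 : ℝ) 1, ‖Y t‖ ≤ ‖Y₀‖ * Real.exp (1 / 2) := by
  let a : NNReal := ‖Y₀‖₊ + 1
  let L : NNReal := ‖Y₀‖₊ + 1 / 2
  have hpl : IsPicardLindelof (fun t y => A t y) (⟨0, by simp⟩ : Icc (0 : ℝ) 1) Y₀ a 0 L
      (1 / 2) := by
    refine ⟨fun t ht => ?_, fun y _ => hA.clm_apply continuousOn_const, fun t ht y hy => ?_, ?_⟩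
    · refine ((A t).lipschitz.weaken ?_).lipschitzOnWith
      exact_mod_cast hb t ht
    · have hy' : ‖y‖ ≤ ‖Y₀‖ + (‖Y₀‖ + 1) := by
        have h1 : ‖y - Y₀‖ ≤ ‖Y₀‖ + 1 := by
          simpa [a, dist_eq_norm] using hy
        have h2 := norm_add_le Y₀ (y - Y₀)
        rw [add_sub_cancel] at h2
        linarith
      have h3 := (A t).le_of_opNorm_le (hb t ht) y
      have : (L : ℝ) = ‖Y₀‖ + 1 / 2 := by simp [L]
      rw [this]
      linarith
    · simp [L, a]
      norm_num
  obtain ⟨Y, hY0, hY⟩ := hpl.exists_eq_forall_mem_Icc_hasDerivWithinAt₀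
  refine ⟨Y, hY0, hY, fun t ht => ?_⟩
  have hY0' : Y 0 = Y₀ := hY0
  have := norm_le_gronwallBound_of_norm_deriv_right_le (f := Y) (f' := fun t => A t (Y t))
    (δ := ‖Y₀‖) (K := 1 / 2) (ε := 0) (a := 0) (b := 1)
    (fun t ht => (hY t ht).continuousWithinAt)
    (fun t ht => (hY t (Ico_subset_Icc_self ht)).mono_of_mem_nhdsWithin (Icc_mem_nhdsGE_of_mem ht))
    (by rw [hY0']) (fun t ht => by
      simpa using (A t).le_of_opNorm_le (hb t (Ico_subset_Icc_self ht)) (Y t)) t ht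
  rw [gronwallBound_ε0] at this
  refine this.trans ?_
  gcongr
  linarith [ht.2]

variable {Ω : X → X →L[ℝ] W →L[ℝ] W} {Ω' : X → X →L[ℝ] X →L[ℝ] W →L[ℝ] W} {x₀ : X} {ρ K K' M C : ℝ}

/-- The solutions `Y`, `Z` of the system along the rays to `x₀ + v` and to `x₀ + v + h`, with the
same initial value, differ at time `1` by the value prescribed by the system, up to a term of second
order. By the integrability condition, the difference `D(t) = Z(t) - Y(t) - t Ω(x₀ + t v)(h) Y(t)`
satisfies a linear equation with a right-hand side of second order, and Grönwall's inequality
applies. -/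
theorem norm_ray_sub_ray_le {v h : X} {Y Z : ℝ → W}
    (hΩ : ∀ x ∈ ball x₀ ρ, HasFDerivAt Ω (Ω' x) x) (hK : ∀ x ∈ ball x₀ ρ, ‖Ω x‖ ≤ K)
    (hKρ : K * ρ ≤ 1 / 2) (hK' : ∀ x ∈ ball x₀ ρ, ‖Ω' x‖ ≤ K')
    (hM : ∀ x ∈ ball x₀ ρ, ∀ y ∈ ball x₀ ρ, ‖Ω' x - Ω' y‖ ≤ M * ‖x - y‖) (hM0 : 0 ≤ M)
    (hcompat : ∀ x ∈ ball x₀ ρ, ∀ v h w,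
      Ω' x v h w + Ω x h (Ω x v w) = Ω' x h v w + Ω x v (Ω x h w))
    (hv : ‖v‖ < ρ) (hvh : ‖v + h‖ < ρ)
    (hY : ∀ t ∈ Icc (0 : ℝ) 1, HasDerivWithinAt Y (Ω (x₀ + t • v) v (Y t)) (Icc 0 1) t)
    (hZ : ∀ t ∈ Icc (0 : ℝ) 1, HasDerivWithinAt Z (Ω (x₀ + t • (v + h)) (v + h) (Z t)) (Icc 0 1) t)
    (h0 : Z 0 = Y 0) (hC : ∀ t ∈ Icc (0 : ℝ) 1, ‖Y t‖ ≤ C) :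
    ‖Z 1 - Y 1 - Ω (x₀ + v) h (Y 1)‖ ≤
      (M * ρ * C + K' * C + (K' * ρ + K) * K * C) * ‖h‖ ^ 2 * (2 * (Real.exp (1 / 2) - 1)) := by
  have hmem : ∀ u : X, ‖u‖ < ρ → ∀ t ∈ Icc (0 : ℝ) 1, x₀ + t • u ∈ ball x₀ ρ := by
    intro u hu t ht
    rw [mem_ball, dist_eq_norm, add_sub_cancel_left, norm_smul, Real.norm_of_nonneg ht.1]
    exact (mul_le_of_le_one_left (norm_nonneg u) ht.2).trans_lt hu
  have hρ : 0 < ρ := (norm_nonneg v).trans_lt hv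
  have hx₀ : x₀ ∈ ball x₀ ρ := mem_ball_self hρ
  have hK0 : 0 ≤ K := (norm_nonneg _).trans (hK _ hx₀)
  have hK'0 : 0 ≤ K' := (norm_nonneg _).trans (hK' _ hx₀)
  have hC0 : 0 ≤ C := (norm_nonneg _).trans (hC 0 (by simp))
  let D : ℝ → W := fun t => Z t - Y t - t • Ω (x₀ + t • v) h (Y t)
  let D' : ℝ → W := fun t => Ω (x₀ + t • (v + h)) (v + h) (Z t) - Ω (x₀ + t • v) v (Y t) -
    (t • (Ω' (x₀ + t • v) v h (Y t) + Ω (x₀ + t • v) h (Ω (x₀ + t • v) v (Y t))) +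
      (1 : ℝ) • Ω (x₀ + t • v) h (Y t))
  have hD : ∀ t ∈ Icc (0 : ℝ) 1, HasDerivWithinAt D (D' t) (Icc 0 1) t := by
    intro t ht
    have hp : HasDerivWithinAt (fun t : ℝ => x₀ + t • v) v (Icc 0 1) t := by
      simpa using ((hasDerivWithinAt_id t (Icc (0 : ℝ) 1)).smul_const v).const_add x₀
    have h1 := (hΩ _ (hmem v hv t ht)).comp_hasDerivWithinAt t hp
    have h2 := (h1.clm_apply (hasDerivWithinAt_const t (Icc (0 : ℝ) 1) h)).clm_apply (hY t ht)
    have h3 := ((hZ t ht).sub (hY t ht)).sub ((hasDerivWithinAt_id t (Icc (0 : ℝ) 1)).smul h2)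
    convert! h3 using 1
    simp [D']
  have hbound : ∀ t ∈ Ico (0 : ℝ) 1, ‖D' t‖ ≤ 1 / 2 * ‖D t‖ +
      (M * ρ * C + K' * C + (K' * ρ + K) * K * C) * ‖h‖ ^ 2 := by
    intro t ht'
    have ht := Ico_subset_Icc_self ht'
    set p := x₀ + t • v with hp
    set q := x₀ + t • (v + h) with hq
    have hpB : p ∈ ball x₀ ρ := hmem v hv t ht
    have hqB : q ∈ ball x₀ ρ := hmem _ hvh t ht
    have hqp : q - p = t • h := by simp [hp, hq]
    have hth : ‖t • h‖ ≤ ‖h‖ := by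
      rw [norm_smul, Real.norm_of_nonneg ht.1]
      exact mul_le_of_le_one_left (norm_nonneg h) ht.2
    have hseg : segment ℝ p q ⊆ ball x₀ ρ := (convex_ball x₀ ρ).segment_subset hpB hqB
    have e1 : ‖Ω q - Ω p - Ω' p (t • h)‖ ≤ M * ‖h‖ * ‖h‖ := by
      rw [← hqp]
      have := (convex_segment p q).norm_image_sub_le_of_norm_hasFDerivWithin_le' (𝕜 := ℝ)
        (f := Ω) (f' := Ω') (φ := Ω' p) (C := M * ‖h‖)
        (fun z hz => (hΩ z (hseg hz)).hasFDerivWithinAt) (fun z hz => by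
          refine (hM z (hseg hz) p hpB).trans ?_
          gcongr
          obtain ⟨a, b, ha, hb, hab, rfl⟩ := hz
          have : a • p + b • q - p = b • (q - p) := by
            rw [show a = 1 - b by linarith]; module
          rw [this, norm_smul, hqp, Real.norm_of_nonneg hb]
          exact (mul_le_of_le_one_left (norm_nonneg _) (by linarith)).trans hth)
        (left_mem_segment ℝ p q) (right_mem_segment ℝ p q)
      refine this.trans ?_
      rw [hqp]
      gcongr
    have e2 : ‖Ω q - Ω p‖ ≤ K' * ‖h‖ := by
      refine ((convex_ball x₀ ρ).norm_image_sub_le_of_norm_hasFDerivWithin_le (𝕜 := ℝ)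
        (fun z hz => (hΩ z hz).hasFDerivWithinAt) hK' hpB hqB).trans ?_
      rw [hqp]
      gcongr
    have hYt := hC t ht
    have hsplit : D' t = Ω q (v + h) (D t) + ((Ω q - Ω p - Ω' p (t • h)) v (Y t) +
        (Ω q - Ω p) h (Y t) + t • (((Ω q - Ω p) v + Ω q h) (Ω p h (Y t)))) := by
      have hc := hcompat p hpB v h (Y t)
      have hc' := congrArg (t • ·) hc
      simp only [smul_add] at hc'
      have hc'' : t • Ω' p v h (Y t) =
          t • Ω' p h v (Y t) + t • Ω p v (Ω p h (Y t)) - t • Ω p h (Ω p v (Y t)) := by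
        rw [← hc']; abel
      simp only [D', D, ← hp, ← hq]
      simp only [smul_add, hc'']
      simp only [map_add, map_sub, map_smul, add_apply, sub_apply, smul_apply, one_smul]
      module
    rw [hsplit]
    have hv' := hv.le
    have n0 : ‖Ω q (v + h) (D t)‖ ≤ 1 / 2 * ‖D t‖ := by
      refine (Ω q (v + h)).le_of_opNorm_le ?_ _
      refine ((Ω q).le_of_opNorm_le (hK q hqB) _).trans (le_trans ?_ hKρ)
      gcongr
    have n1 : ‖(Ω q - Ω p - Ω' p (t • h)) v (Y t)‖ ≤ M * ‖h‖ * ‖h‖ * ρ * C :=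
      (ContinuousLinearMap.le_opNorm₂ _ _ _).trans (by gcongr)
    have n2 : ‖(Ω q - Ω p) h (Y t)‖ ≤ K' * ‖h‖ * ‖h‖ * C :=
      (ContinuousLinearMap.le_opNorm₂ _ _ _).trans (by gcongr)
    have n3 : ‖t • (((Ω q - Ω p) v + Ω q h) (Ω p h (Y t)))‖ ≤
        (K' * ‖h‖ * ρ + K * ‖h‖) * (K * ‖h‖ * C) := by
      rw [norm_smul, Real.norm_of_nonneg ht.1]
      refine (mul_le_of_le_one_left (norm_nonneg _) ht.2).trans ?_
      refine (ContinuousLinearMap.le_opNorm _ _).trans ?_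
      have a1 : ‖(Ω q - Ω p) v + Ω q h‖ ≤ K' * ‖h‖ * ρ + K * ‖h‖ := by
        refine (norm_add_le _ _).trans (add_le_add ?_ ?_)
        · exact (ContinuousLinearMap.le_opNorm _ _).trans (by gcongr)
        · exact (ContinuousLinearMap.le_opNorm _ _).trans (by gcongr; exact hK q hqB)
      have a2 : ‖Ω p h (Y t)‖ ≤ K * ‖h‖ * C :=
        (ContinuousLinearMap.le_opNorm₂ _ _ _).trans (by gcongr; exact hK p hpB)
      gcongr
    refine (norm_add_le _ _).trans (add_le_add n0 ?_)
    refine (norm_add₃_le.trans (add_le_add (add_le_add n1 n2) n3)).trans (le_of_eq ?_)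
    ring
  have := norm_le_gronwallBound_of_norm_deriv_right_le (f := D) (f' := D') (δ := 0) (a := 0) (b := 1)
    (fun t ht => (hD t ht).continuousWithinAt)
    (fun t ht => (hD t (Ico_subset_Icc_self ht)).mono_of_mem_nhdsWithin (Icc_mem_nhdsGE_of_mem ht))
    (by simp [D, h0]) hbound 1 (by simp)
  rw [gronwallBound_of_K_ne_0 (by norm_num)] at this
  have hD1 : D 1 = Z 1 - Y 1 - Ω (x₀ + v) h (Y 1) := by simp [D]
  rw [hD1] at this
  refine this.trans (le_of_eq ?_)
  beta_reduce
  rw [show (1 / 2 : ℝ) * (1 - 0) = 1 / 2 by norm_num]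
  ring

/-- The Frobenius theorem for a linear total differential system `df = Ω f`, with the integrability
condition in the form `dΩ(v, h) + Ω(h) Ω(v)` symmetric in `v`, `h`. The solution is obtained by
integrating the system along the rays from `x₀`. -/
theorem exists_solution_total_system [CompleteSpace W] {U : Set X} (hU : IsOpen U) (hx₀ : x₀ ∈ U)
    (hΩ : ContDiffOn ℝ ∞ Ω U)
    (hcompat : ∀ x ∈ U, ∀ v h w, fderiv ℝ Ω x v h w + Ω x h (Ω x v w) =
      fderiv ℝ Ω x h v w + Ω x v (Ω x h w)) (Y₀ : W) :
    ∃ ρ > 0, ball x₀ ρ ⊆ U ∧ ∃ f : X → W, f x₀ = Y₀ ∧ ContDiffOn ℝ ∞ f (ball x₀ ρ) ∧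
      ∀ x ∈ ball x₀ ρ, HasFDerivAt f ((Ω x).flip (f x)) x := by
  have hd : ContDiffOn ℝ ∞ (fderiv ℝ Ω) U := hΩ.fderiv_of_isOpen hU (m := ∞) (by simp)
  have hdd : ContDiffOn ℝ ∞ (fderiv ℝ (fderiv ℝ Ω)) U := hd.fderiv_of_isOpen hU (m := ∞) (by simp)
  have hnear := ((hU.eventually_mem hx₀).and
    (eventually_norm_le_add_one (hΩ.continuousOn.continuousAt (hU.mem_nhds hx₀)))).and
    ((eventually_norm_le_add_one (hd.continuousOn.continuousAt (hU.mem_nhds hx₀))).and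
      (eventually_norm_le_add_one (hdd.continuousOn.continuousAt (hU.mem_nhds hx₀))))
  obtain ⟨ρ₁, hρ₁, hball⟩ := Metric.eventually_nhds_iff_ball.1 hnear
  set K := ‖Ω x₀‖ + 1 with hKdef
  have hKpos : 0 < K := by positivity
  obtain ⟨ρ, hρ, hρ1, hKρ⟩ : ∃ ρ > 0, ρ ≤ ρ₁ ∧ K * ρ ≤ 1 / 2 := by
    refine ⟨min ρ₁ (1 / (2 * K)), by positivity, min_le_left _ _, ?_⟩
    calc K * min ρ₁ (1 / (2 * K)) ≤ K * (1 / (2 * K)) := by gcongr; exact min_le_right _ _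
      _ = 1 / 2 := by field_simp
  have hB : ball x₀ ρ ⊆ ball x₀ ρ₁ := ball_subset_ball hρ1
  have hBU : ball x₀ ρ ⊆ U := fun x hx => (hball x (hB hx)).1.1
  have hΩd : ∀ x ∈ ball x₀ ρ, HasFDerivAt Ω (fderiv ℝ Ω x) x := fun x hx =>
    ((hΩ.contDiffAt (hU.mem_nhds (hBU hx))).differentiableAt (by simp)).hasFDerivAt
  have hM : ∀ x ∈ ball x₀ ρ, ∀ y ∈ ball x₀ ρ, ‖fderiv ℝ Ω x - fderiv ℝ Ω y‖ ≤
      (‖fderiv ℝ (fderiv ℝ Ω) x₀‖ + 1) * ‖x - y‖ := fun x hx y hy =>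
    (convex_ball x₀ ρ).norm_image_sub_le_of_norm_hasFDerivWithin_le (𝕜 := ℝ)
      (fun z hz => ((hd.contDiffAt (hU.mem_nhds (hBU hz))).differentiableAt
        (by simp)).hasFDerivAt.hasFDerivWithinAt)
      (fun z hz => (hball z (hB hz)).2.2) hy hx
  have hmem : ∀ v : X, ‖v‖ < ρ → ∀ t ∈ Icc (0 : ℝ) 1, x₀ + t • v ∈ ball x₀ ρ := by
    intro u hu t ht
    rw [mem_ball, dist_eq_norm, add_sub_cancel_left, norm_smul, Real.norm_of_nonneg ht.1]
    exact (mul_le_of_le_one_left (norm_nonneg u) ht.2).trans_lt hu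
  have hsol : ∀ v : X, ‖v‖ < ρ → ∃ Y : ℝ → W, Y 0 = Y₀ ∧
      (∀ t ∈ Icc (0 : ℝ) 1, HasDerivWithinAt Y (Ω (x₀ + t • v) v (Y t)) (Icc 0 1) t) ∧
      ∀ t ∈ Icc (0 : ℝ) 1, ‖Y t‖ ≤ ‖Y₀‖ * Real.exp (1 / 2) := by
    intro v hv
    refine exists_solution_linear_ode (A := fun t => Ω (x₀ + t • v) v) ?_ ?_ Y₀
    · refine ContinuousOn.clm_apply ?_ continuousOn_const
      exact hΩ.continuousOn.comp (by fun_prop) fun t ht => hBU (hmem v hv t ht)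
    · intro t ht
      refine ((Ω _).le_of_opNorm_le (hball _ (hB (hmem v hv t ht))).1.2 v).trans (le_trans ?_ hKρ)
      gcongr
  choose! Y hY0 hY hYb using hsol
  have hder : ∀ x ∈ ball x₀ ρ,
      HasFDerivAt (fun x => Y (x - x₀) 1) ((Ω x).flip (Y (x - x₀) 1)) x := by
    intro x hx
    have hv : ‖x - x₀‖ < ρ := by simpa [dist_eq_norm] using hx
    rw [hasFDerivAt_iff_isLittleO_nhds_zero]
    refine Asymptotics.IsBigO.trans_isLittleO (g := fun h : X => ‖h‖ ^ 2) ?_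
      (by simpa using Asymptotics.isLittleO_norm_pow_id (E' := X) one_lt_two)
    refine Asymptotics.IsBigO.of_bound
      (((‖fderiv ℝ (fderiv ℝ Ω) x₀‖ + 1) * ρ * (‖Y₀‖ * Real.exp (1 / 2)) +
        (‖fderiv ℝ Ω x₀‖ + 1) * (‖Y₀‖ * Real.exp (1 / 2)) +
        ((‖fderiv ℝ Ω x₀‖ + 1) * ρ + K) * K * (‖Y₀‖ * Real.exp (1 / 2))) *
          (2 * (Real.exp (1 / 2) - 1))) ?_
    have hnh : ∀ᶠ h : X in nhds 0, ‖x - x₀ + h‖ < ρ := by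
      have : ContinuousAt (fun h : X => ‖x - x₀ + h‖) 0 := by fun_prop
      exact this.eventually_lt continuousAt_const (by simpa using hv)
    filter_upwards [hnh] with h hh
    have := norm_ray_sub_ray_le (C := ‖Y₀‖ * Real.exp (1 / 2)) hΩd
      (fun z hz => (hball z (hB hz)).1.2) hKρ (fun z hz => (hball z (hB hz)).2.1) hM (by positivity)
      (fun z hz => hcompat z (hBU hz)) hv hh (hY _ hv) (hY _ hh) (by rw [hY0 _ hv, hY0 _ hh])
      (hYb _ hv)
    rw [show x + h - x₀ = x - x₀ + h by abel, ContinuousLinearMap.flip_apply]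
    rw [add_sub_cancel] at this
    refine this.trans (le_of_eq ?_)
    rw [norm_pow, norm_norm]
    ring
  refine ⟨ρ, hρ, hBU, fun x => Y (x - x₀) 1, ?_, ?_, hder⟩
  · have h00 : ‖(0 : X)‖ < ρ := by simpa using hρ
    have := constant_of_has_deriv_right_zero (f := Y 0) (a := 0) (b := 1)
      (fun t ht => (hY 0 h00 t ht).continuousWithinAt) (fun t ht => by
        have := (hY 0 h00 t (Ico_subset_Icc_self ht)).mono_of_mem_nhdsWithin
          (Icc_mem_nhdsGE_of_mem ht)
        simpa using this) 1 (by simp)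
    simp only [sub_self]
    rw [this, hY0 0 h00]
  · refine contDiffOn_of_fderiv_eq (Ω := fun x => (Ω x).flip) isOpen_ball ?_ hder
    exact (ContinuousLinearMap.flipₗᵢ ℝ X W W).contDiff.comp_contDiffOn (hΩ.mono hBU)

end TotalSystem

section MatrixSystem

set_option maxSynthPendingDepth 3

open Matrix Metric

variable {N : ℕ} {ι τ : Type*} [Fintype ι] [Fintype τ]

/-- The form `v ↦ (Y ↦ ∑ᵢ vⁱ Bᵢ Y)` with values in the endomorphisms of a space of matrices. -/
def leftMulForm (B : Fin N → Matrix ι ι ℝ) : Coord N →L[ℝ] (ι → τ → ℝ) →L[ℝ] (ι → τ → ℝ) :=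
  ∑ i, (EuclideanSpace.proj i : Coord N →L[ℝ] ℝ).smulRight
    (ContinuousLinearMap.pi fun a => ∑ b, B i a b • ContinuousLinearMap.proj b)

theorem leftMulForm_apply (B : Fin N → Matrix ι ι ℝ) (v : Coord N) (w : ι → τ → ℝ) :
    Matrix.of (leftMulForm B v w) = ∑ i, v i • (B i * Matrix.of w) := by
  ext a t
  simp [leftMulForm, Finset.sum_apply, Matrix.mul_apply, Matrix.sum_apply]

theorem fderiv_leftMulForm {A : Fin N → Coord N → Matrix ι ι ℝ} {U : Set (Coord N)}
    (hU : IsOpen U) (hA : ∀ i, SmoothMatOn (A i) U) {x : Coord N} (hx : x ∈ U) :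
    ContDiffOn ℝ ∞ (fun y => leftMulForm (τ := τ) fun i => A i y) U ∧ ∀ v,
      fderiv ℝ (fun y => leftMulForm (τ := τ) fun i => A i y) x v =
        leftMulForm fun i => ∑ j, v j • pdM j (A i) x := by
  classical
  let L : (Fin N → ι → ι → ℝ) →ₗ[ℝ] Coord N →L[ℝ] (ι → τ → ℝ) →L[ℝ] (ι → τ → ℝ) :=
    { toFun := fun B => leftMulForm fun i => Matrix.of (B i)
      map_add' := fun B B' => by
        ext v w a t
        simp [leftMulForm, Finset.sum_add_distrib, add_mul, mul_add]
      map_smul' := fun c B => by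
        ext v w a t
        simp [leftMulForm, Finset.mul_sum, mul_left_comm, mul_assoc] }
  let L' := LinearMap.toContinuousLinearMap L
  have hs : ContDiffOn ℝ ∞ (fun y => (fun i a b => A i y a b : Fin N → ι → ι → ℝ)) U :=
    contDiffOn_pi.2 fun i => contDiffOn_pi.2 fun a => contDiffOn_pi.2 fun b => hA i a b
  refine ⟨L'.contDiff.comp_contDiffOn hs, fun v => ?_⟩
  have hd : HasFDerivAt (fun y => (fun i a b => A i y a b : Fin N → ι → ι → ℝ))
      (ContinuousLinearMap.pi fun i => ContinuousLinearMap.pi fun a => ContinuousLinearMap.pi fun b =>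
        fderiv ℝ (fun y => A i y a b) x) x :=
    hasFDerivAt_pi.2 fun i => hasFDerivAt_pi.2 fun a => hasFDerivAt_pi.2 fun b =>
      ((hA i).differentiableAt hU hx a b).hasFDerivAt
  have hd' := L'.hasFDerivAt.comp x hd
  change fderiv ℝ (L' ∘ fun y => (fun i a b => A i y a b : Fin N → ι → ι → ℝ)) x v = _
  rw [hd'.fderiv]
  change leftMulForm _ = _
  congr 1
  ext i a b
  rw [Matrix.sum_apply]
  simp [fderiv_apply_eq_sum_pd]

/-- The Frobenius theorem for a linear system `∂ᵢY = AᵢY` for a matrix-valued function `Y`. -/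
theorem exists_solution_matrix_system {A : Fin N → Coord N → Matrix ι ι ℝ} {U : Set (Coord N)}
    (hU : IsOpen U) {x₀ : Coord N} (hx₀ : x₀ ∈ U) (hA : ∀ i, SmoothMatOn (A i) U)
    (hcompat : ∀ x ∈ U, ∀ i j, pdM i (A j) x + A j x * A i x = pdM j (A i) x + A i x * A j x)
    (Y₀ : Matrix ι τ ℝ) :
    ∃ ρ > 0, ball x₀ ρ ⊆ U ∧ ∃ Y : Coord N → Matrix ι τ ℝ, Y x₀ = Y₀ ∧
      SmoothMatOn Y (ball x₀ ρ) ∧ ∀ x ∈ ball x₀ ρ, ∀ i, pdM i Y x = A i x * Y x := by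
  obtain ⟨ρ, hρ, hB, f, hf0, hfs, hf⟩ := exists_solution_total_system
    (W := ι → τ → ℝ) hU hx₀ (fderiv_leftMulForm (τ := τ) hU hA hx₀).1 (by
      intro x hx v h w
      simp only [(fderiv_leftMulForm (τ := τ) hU hA hx).2]
      apply Matrix.of.injective
      rw [← Matrix.of_add_of, ← Matrix.of_add_of]
      simp only [leftMulForm_apply]
      have key : ∀ v h : Coord N,
          (∑ i, h i • ((∑ j, v j • pdM j (A i) x) * Matrix.of w) +
            ∑ i, h i • (A i x * ∑ j, v j • (A j x * Matrix.of w))) =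
          ∑ i, ∑ j, (h i * v j) • ((pdM j (A i) x + A i x * A j x) * Matrix.of w) := by
        intro v h
        simp only [← Finset.sum_add_distrib, Matrix.sum_mul, Matrix.mul_sum, Finset.smul_sum,
          Matrix.smul_mul, Matrix.mul_smul, smul_smul, Matrix.add_mul, smul_add, Matrix.mul_assoc]
      refine (key v h).trans (Eq.trans ?_ (key h v).symm)
      rw [Finset.sum_comm]
      refine Finset.sum_congr rfl fun i _ => Finset.sum_congr rfl fun j _ => ?_
      rw [hcompat x hx, mul_comm]) (fun a t => Y₀ a t)
  refine ⟨ρ, hρ, hB, fun x => Matrix.of (f x), ?_, fun a t => ?_, fun x hx i => ?_⟩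
  · exact congrArg Matrix.of hf0
  · exact contDiffOn_pi.1 (contDiffOn_pi.1 hfs a) t
  · ext a t
    have := hasFDerivAt_pi'.1 (hasFDerivAt_pi'.1 (hf x hx) a) t
    change fderiv ℝ (fun y => f y a t) x (basisVec i) = _
    rw [this.fderiv]
    simp [leftMulForm, basisVec, Matrix.mul_apply]

end MatrixSystem

/-! ### Linear algebra of pseudo-Euclidean spaces -/

section PseudoEuclidean

open Matrix

/-- The Gram matrix `diag(-1, …, -1, 1, …, 1)` of the scalar product `pseudoInner s`. -/
def signMat (m s : ℕ) : Matrix (Fin m) (Fin m) ℝ :=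
  Matrix.diagonal fun a => if (a : ℕ) < s then -1 else 1

variable {m s : ℕ}

theorem pseudoInner_eq (x y : EuclideanSpace ℝ (Fin m)) :
    pseudoInner s x y = ∑ a, (x a * (if (a : ℕ) < s then -1 else 1)) * y a := by
  rw [pseudoInner]
  exact Finset.sum_congr rfl fun a _ => by ring

theorem mul_signMat_mul_transpose_apply {ι κ : Type*} (E : Matrix ι (Fin m) ℝ)
    (E' : Matrix κ (Fin m) ℝ) (i : ι) (j : κ) :
    (E * signMat m s * E'ᵀ) i j =
      pseudoInner s (WithLp.toLp 2 (E i)) (WithLp.toLp 2 (E' j)) := by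
  rw [Matrix.mul_apply, pseudoInner_eq]
  simp [signMat, Matrix.mul_diagonal]

theorem signMat_transpose : (signMat m s)ᵀ = signMat m s := by
  simp [signMat]

theorem signMat_mul_self : signMat m s * signMat m s = 1 := by
  rw [signMat, Matrix.diagonal_mul_diagonal, ← Matrix.diagonal_one]
  congr 1
  ext a
  split_ifs <;> simp

theorem card_subtype_lt (h : s ≤ m) : Fintype.card {a : Fin m // (a : ℕ) < s} = s := by
  rw [Fintype.card_subtype]
  simpa using Fin.card_filter_val_lt (n := m) (m := s) ▸ min_eq_right h

/-- Every nondegenerate symmetric matrix is the Gram matrix of a basis of a pseudo-Euclidean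
space. -/
theorem exists_mul_signMat_mul_transpose {ι : Type*} [Fintype ι] [DecidableEq ι]
    (hm : Fintype.card ι = m) {G : Matrix ι ι ℝ} (hG : Gᵀ = G) (hdet : G.det ≠ 0) :
    ∃ s ≤ m, ∃ E : Matrix ι (Fin m) ℝ, E * signMat m s * Eᵀ = G := by
  subst hm
  let B := Matrix.toBilin' G
  have hB : ∀ x y, B x y = B y x := by
    intro x y
    rw [Matrix.toBilin'_apply', Matrix.toBilin'_apply', Matrix.dotProduct_mulVec,
      ← Matrix.mulVec_transpose, hG, dotProduct_comm]
  have hBn : B.Nondegenerate :=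
    LinearMap.BilinForm.nondegenerate_toBilin'_iff_det_ne_zero.2 hdet
  let Q := B.toQuadraticMap
  have hQB : QuadraticMap.associated (R := ℝ) Q = B :=
    QuadraticMap.associated_left_inverse ℝ hB
  obtain ⟨w, hw, ⟨e⟩⟩ := QuadraticForm.equivalent_one_neg_one_weighted_sum_squared Q (by
    rw [hQB]; exact hBn.1)
  -- reorder the diagonal entries so that the negative ones come first
  have hcard : Module.finrank ℝ (ι → ℝ) = Fintype.card ι := Module.finrank_fintype_fun_eq_card ℝ
  have hle : Fintype.card {a // w a = -1} ≤ Fintype.card ι := by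
    refine (Fintype.card_subtype_le _).trans ?_
    simp
  have hc : Fintype.card {a // w a = -1} =
      Fintype.card {b : Fin (Fintype.card ι) // (b : ℕ) < Fintype.card {a // w a = -1}} := by
    rw [card_subtype_lt hle]
  have hc' : Fintype.card {a // ¬ w a = -1} =
      Fintype.card {b : Fin (Fintype.card ι) // ¬ (b : ℕ) < Fintype.card {a // w a = -1}} := by
    rw [Fintype.card_subtype_compl, Fintype.card_subtype_compl, ← hc, Fintype.card_fin,
      Fintype.card_fin]
    exact congrArg (· - _) hcard
  let σ := (Equiv.sumCompl fun a => w a = -1).symm.trans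
    (((Fintype.equivOfCardEq hc).sumCongr (Fintype.equivOfCardEq hc')).trans
      (Equiv.sumCompl fun b : Fin (Fintype.card ι) => (b : ℕ) < Fintype.card {a // w a = -1}))
  have hσ : ∀ a, (if (σ a : ℕ) < Fintype.card {a // w a = -1} then (-1 : ℝ) else 1) = w a := by
    intro a
    by_cases h : w a = -1
    · have h2 : (σ a : ℕ) < Fintype.card {a // w a = -1} := by
        have := (Fintype.equivOfCardEq hc ⟨a, h⟩).2
        simpa [σ, h] using this
      rw [if_pos h2, h]
    · have h2 : ¬ (σ a : ℕ) < Fintype.card {a // w a = -1} := by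
        have := (Fintype.equivOfCardEq hc' ⟨a, h⟩).2
        simpa [σ, h] using this
      rw [if_neg h2, (hw a).resolve_left h]
  refine ⟨_, hle, Matrix.of fun i b => e (Pi.single i 1) (σ.symm b), ?_⟩
  have hQ : ∀ x, B x x = ∑ a, w a * (e x a * e x a) := by
    intro x
    have := e.map_app x
    rw [QuadraticMap.weightedSumSquares_apply] at this
    simpa [Q] using this.symm
  have hBe : ∀ x y, B x y = ∑ a, w a * (e x a * e y a) := by
    intro x y
    have h1 := hQ (x + y)
    simp only [map_add, LinearMap.add_apply, hB y x, hQ x, hQ y, Pi.add_apply] at h1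
    have h2 : ∑ a, w a * ((e x a + e y a) * (e x a + e y a)) =
        ∑ a, w a * (e x a * e x a) + ∑ a, w a * (e y a * e y a) +
          2 * ∑ a, w a * (e x a * e y a) := by
      rw [Finset.mul_sum, ← Finset.sum_add_distrib, ← Finset.sum_add_distrib]
      exact Finset.sum_congr rfl fun a _ => by ring
    linarith
  ext i j
  rw [mul_signMat_mul_transpose_apply, pseudoInner_eq, ← σ.sum_comp]
  have : B (Pi.single i 1) (Pi.single j 1) = G i j := Matrix.toBilin'_single G i j
  rw [← this, hBe]
  refine Finset.sum_congr rfl fun a _ => ?_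
  rw [hσ]
  simp
  ring

/-- **Sylvester's law of inertia**: pseudo-Euclidean spaces related by an isometry have equal
indices. -/
theorem index_eq_of_isometry {s₁ s₂ : ℕ} (h₁ : s₁ ≤ m) (h₂ : s₂ ≤ m)
    {A : Matrix (Fin m) (Fin m) ℝ} (hA : A * signMat m s₂ * Aᵀ = signMat m s₁) : s₁ = s₂ := by
  let w : ℕ → Fin m → ℝ := fun s a => if (a : ℕ) < s then -1 else 1
  have hw : ∀ s ≤ m, {a | w s a < 0}.ncard = s := by
    intro s hs
    have : {a | w s a < 0} = {a : Fin m | (a : ℕ) < s} := by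
      ext a
      by_cases h : (a : ℕ) < s <;> simp [w, h]
    rw [this, ← Nat.card_coe_set_eq, Nat.card_eq_fintype_card]
    exact card_subtype_lt hs
  have hq : ∀ (s : ℕ) (x : Fin m → ℝ),
      QuadraticMap.weightedSumSquares ℝ (w s) x = x ⬝ᵥ signMat m s *ᵥ x := by
    intro s x
    rw [QuadraticMap.weightedSumSquares_apply, dotProduct]
    refine Finset.sum_congr rfl fun a _ => ?_
    rw [signMat, Matrix.mulVec_diagonal, smul_eq_mul]
    simp only [w]
    ring
  have hinj : Function.Injective (Matrix.mulVecLin Aᵀ) := by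
    rw [← LinearMap.ker_eq_bot, LinearMap.ker_eq_bot']
    intro x hx
    rw [Matrix.mulVecLin_apply] at hx
    have h3 : signMat m s₁ *ᵥ x = 0 := by
      rw [← hA, ← Matrix.mulVec_mulVec, hx, Matrix.mulVec_zero]
    rw [← Matrix.one_mulVec x, ← signMat_mul_self (s := s₁), ← Matrix.mulVec_mulVec, h3,
      Matrix.mulVec_zero]
  have he : QuadraticMap.Equivalent (QuadraticMap.weightedSumSquares ℝ (w s₁))
      (QuadraticMap.weightedSumSquares ℝ (w s₂)) := by
    refine ⟨⟨LinearEquiv.ofInjectiveEndo _ hinj, fun x => ?_⟩⟩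
    change QuadraticMap.weightedSumSquares ℝ (w s₂) (Aᵀ *ᵥ x) = _
    rw [hq, hq, ← hA, Matrix.mulVec_transpose, ← Matrix.dotProduct_mulVec, Matrix.mulVec_mulVec,
      ← Matrix.mulVec_transpose, Matrix.mulVec_mulVec]
  have := he.sigNeg_eq
  rwa [QuadraticForm.sigNeg_weightedSumSquares, QuadraticForm.sigNeg_weightedSumSquares, hw _ h₁,
    hw _ h₂] at this

end PseudoEuclidean

/-! ### The Levi-Civita connection and flat coordinates -/

section FlatCoordinates

open Matrix Metric

variable {N : ℕ} {g : Coord N → Matrix (Fin N) (Fin N) ℝ} {U : Set (Coord N)}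

/-- The matrix `(Γᵏₗⱼ)ₖⱼ` of the covariant derivative in the direction of `∂ₗ`. -/
def connMat (g : Coord N → Matrix (Fin N) (Fin N) ℝ) (l : Fin N) (x : Coord N) :
    Matrix (Fin N) (Fin N) ℝ :=
  Matrix.of fun k j => christoffel g k l j x

@[simp] theorem connMat_apply (l k j : Fin N) (x : Coord N) :
    connMat g l x k j = christoffel g k l j x := rfl

/-- The Jacobian matrix of `u`. -/
def jacMat (u : Fin N → Coord N → ℝ) (x : Coord N) : Matrix (Fin N) (Fin N) ℝ :=
  Matrix.of fun α i => pd i (u α) x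

@[simp] theorem jacMat_apply (u : Fin N → Coord N → ℝ) (x : Coord N) (α i : Fin N) :
    jacMat u x α i = pd i (u α) x := rfl

theorem pd_symm (hU : IsOpen U) (hsymm : ∀ x ∈ U, (g x)ᵀ = g x) {x : Coord N} (hx : x ∈ U)
    (l i j : Fin N) : pd l (fun y => g y i j) x = pd l (fun y => g y j i) x :=
  pd_congr hU (fun y hy => congrFun (congrFun (hsymm y hy) j) i) hx l

theorem christoffel_symm (hU : IsOpen U) (hsymm : ∀ x ∈ U, (g x)ᵀ = g x) {x : Coord N}
    (hx : x ∈ U) (k i j : Fin N) : christoffel g k i j x = christoffel g k j i x := by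
  simp only [christoffel]
  congr 1
  refine Finset.sum_congr rfl fun l _ => ?_
  rw [pd_symm hU hsymm hx l i j]
  ring

theorem smoothMatOn_connMat (hU : IsOpen U) (hg : SmoothMatOn g U) (hdet : ∀ x ∈ U, (g x).det ≠ 0)
    (l : Fin N) : SmoothMatOn (connMat g l) U := by
  intro k j
  simp only [connMat_apply, christoffel]
  refine contDiffOn_const.mul (ContDiffOn.sum fun p _ => (hg.inv hdet k p).mul ?_)
  exact ((contDiffOn_pd hU (hg _ _) _).add (contDiffOn_pd hU (hg _ _) _)).sub
    (contDiffOn_pd hU (hg _ _) _)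

/-- The Levi-Civita connection preserves the metric. -/
theorem pdM_metric (hU : IsOpen U) (hsymm : ∀ x ∈ U, (g x)ᵀ = g x)
    (hdet : ∀ x ∈ U, (g x).det ≠ 0) {x : Coord N} (hx : x ∈ U) (l : Fin N) :
    pdM l g x = (connMat g l x)ᵀ * g x + g x * connMat g l x := by
  let D : Matrix (Fin N) (Fin N) ℝ := Matrix.of fun p j =>
    pd l (fun y => g y p j) x + pd j (fun y => g y p l) x - pd p (fun y => g y l j) x
  have hD : g x * connMat g l x = (1 / 2 : ℝ) • D := by
    have : connMat g l x = (1 / 2 : ℝ) • ((g x)⁻¹ * D) := by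
      ext k j
      simp [christoffel, D, Matrix.mul_apply]
    rw [this, Matrix.mul_smul, ← Matrix.mul_assoc,
      Matrix.mul_nonsing_inv _ (isUnit_iff_ne_zero.2 (hdet x hx)), Matrix.one_mul]
  have hD' : (connMat g l x)ᵀ * g x = (1 / 2 : ℝ) • Dᵀ := by
    rw [← Matrix.transpose_smul, ← hD, Matrix.transpose_mul, hsymm x hx]
  rw [hD, hD']
  ext i j
  simp only [pdM_apply, Matrix.add_apply, Matrix.smul_apply, Matrix.transpose_apply, D,
    Matrix.of_apply, smul_eq_mul]
  rw [pd_symm hU hsymm hx l j i, pd_symm hU hsymm hx i j l, pd_symm hU hsymm hx j i l]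
  ring

/-- Near every point, a flat connection has a full system of flat coordinates `u^α`: their
differentials are parallel, that is, `∂ₗJ = J Γₗ` for the Jacobian matrix `J`. -/
theorem exists_flat_coordinates (hU : IsOpen U) (hg : SmoothMatOn g U)
    (hsymm : ∀ x ∈ U, (g x)ᵀ = g x) (hdet : ∀ x ∈ U, (g x).det ≠ 0) (hflat : IsFlatOn g U)
    {x₀ : Coord N} (hx₀ : x₀ ∈ U) :
    ∃ ρ > 0, ball x₀ ρ ⊆ U ∧ ∃ u : Fin N → Coord N → ℝ,
      (∀ α, ContDiffOn ℝ ∞ (u α) (ball x₀ ρ)) ∧ jacMat u x₀ = 1 ∧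
      ∀ x ∈ ball x₀ ρ, (jacMat u x).det ≠ 0 ∧
        ∀ l, pdM l (jacMat u) x = jacMat u x * connMat g l x := by
  have hG := smoothMatOn_connMat hU hg hdet
  obtain ⟨ρ, hρ, hB, Y, hY0, hYs, hY⟩ := exists_solution_matrix_system hU hx₀
    (fun l => (hG l).transpose) (by
      intro x hx i j
      ext a b
      have := hflat x hx b a i j
      rw [curvature, Finset.sum_sub_distrib] at this
      simp only [pdM_transpose, Matrix.add_apply, Matrix.transpose_apply, Matrix.mul_apply,
        pdM_apply, connMat_apply]
      simp only [mul_comm (christoffel g _ j a x), mul_comm (christoffel g _ i a x)]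
      change pd i (christoffel g b j a) x + _ = pd j (christoffel g b i a) x + _
      linarith) (1 : Matrix (Fin N) (Fin N) ℝ)
  have hpot : ∀ α, ∃ f : Coord N → ℝ, ContDiffOn ℝ ∞ f (ball x₀ ρ) ∧
      ∀ x ∈ ball x₀ ρ, ∀ i, pd i f x = Y x i α := by
    intro α
    refine exists_potential isOpen_ball (convex_ball _ _) (fun i => hYs i α) fun x hx i j => ?_
    have h1 := congrFun (congrFun (hY x hx i) j) α
    have h2 := congrFun (congrFun (hY x hx j) i) α
    rw [pdM_apply, Matrix.mul_apply] at h1 h2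
    rw [h1, h2]
    refine Finset.sum_congr rfl fun b _ => ?_
    rw [Matrix.transpose_apply, Matrix.transpose_apply, connMat_apply, connMat_apply,
      christoffel_symm hU hsymm (hB hx)]
  choose u hus hu using hpot
  have hJ : ∀ x ∈ ball x₀ ρ, jacMat u x = (Y x)ᵀ := fun x hx => by
    ext α i
    exact hu α x hx i
  have hx₀B : x₀ ∈ ball x₀ ρ := mem_ball_self hρ
  have hdetY : ∀ᶠ x in nhds x₀, (Y x).det ≠ 0 := by
    refine (hYs.det.continuousOn.continuousAt (isOpen_ball.mem_nhds hx₀B)).eventually_ne ?_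
    rw [hY0]
    simp
  obtain ⟨ρ', hρ', hdet'⟩ := Metric.eventually_nhds_iff_ball.1 hdetY
  have hsub : ball x₀ (min ρ ρ') ⊆ ball x₀ ρ := ball_subset_ball (min_le_left _ _)
  refine ⟨min ρ ρ', by positivity, hsub.trans hB, u, fun α => (hus α).mono hsub, ?_, ?_⟩
  · rw [hJ x₀ hx₀B, hY0, Matrix.transpose_one]
  · intro x hx
    refine ⟨?_, fun l => ?_⟩
    · rw [hJ x (hsub hx), Matrix.det_transpose]
      exact hdet' x (ball_subset_ball (min_le_right _ _) hx)
    · rw [hJ x (hsub hx), pdM_congr isOpen_ball hJ (hsub hx), pdM_transpose, hY x (hsub hx),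
        Matrix.transpose_mul, Matrix.transpose_transpose]

end FlatCoordinates

/-! ### Frobenius structures in flat coordinates -/

section LocalFrobenius

open Matrix Metric

variable {N : ℕ}

/-- The matrix `(cᵢⱼₖ)ⱼₖ` of the multiplication by `∂ᵢ`, with lowered index. -/
def mulMat (c : Fin N → Fin N → Fin N → Coord N → ℝ) (i : Fin N) (x : Coord N) :
    Matrix (Fin N) (Fin N) ℝ :=
  Matrix.of fun j k => c i j k x

@[simp] theorem mulMat_apply (c : Fin N → Fin N → Fin N → Coord N → ℝ) (i j k : Fin N)
    (x : Coord N) : mulMat c i x j k = c i j k x := rfl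

/-- The components `gᵢⱼ` and `cᵢⱼₖ` of a Frobenius structure on an open set of the coordinate
space, with a system `u` of flat coordinates in which the metric is `η`. -/
structure IsFlatFrobeniusOn (V : Set (Coord N)) (g : Coord N → Matrix (Fin N) (Fin N) ℝ)
    (c : Fin N → Fin N → Fin N → Coord N → ℝ) (u : Fin N → Coord N → ℝ)
    (η : Matrix (Fin N) (Fin N) ℝ) : Prop where
  isOpen : IsOpen V
  convex : Convex ℝ V
  smooth_conn : ∀ l, SmoothMatOn (connMat g l) V
  conn_symm : ∀ x ∈ V, ∀ k i j, christoffel g k i j x = christoffel g k j i x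
  smooth_mul : ∀ i, SmoothMatOn (mulMat c i) V
  mul_symm : ∀ x ∈ V, ∀ i, (mulMat c i x)ᵀ = mulMat c i x
  mul_swap : ∀ x ∈ V, ∀ i j k, c i j k x = c j i k x
  assoc : ∀ x ∈ V, ∀ i j, mulMat c i x * (g x)⁻¹ * mulMat c j x =
    mulMat c j x * (g x)⁻¹ * mulMat c i x
  potential : ∀ x ∈ V, ∀ l i j k, covDeriv₃ g c l i j k x = covDeriv₃ g c i l j k x
  smooth_coord : ∀ α, ContDiffOn ℝ ∞ (u α) V
  jac_det : ∀ x ∈ V, (jacMat u x).det ≠ 0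
  pdM_jac : ∀ x ∈ V, ∀ l, pdM l (jacMat u) x = jacMat u x * connMat g l x
  metric_symm : ηᵀ = η
  metric_det : η.det ≠ 0
  metric_eq : ∀ x ∈ V, g x = (jacMat u x)ᵀ * η * jacMat u x

namespace IsFlatFrobeniusOn

variable {V : Set (Coord N)} {g : Coord N → Matrix (Fin N) (Fin N) ℝ}
  {c : Fin N → Fin N → Fin N → Coord N → ℝ} {u : Fin N → Coord N → ℝ}
  {η : Matrix (Fin N) (Fin N) ℝ} {x : Coord N}

/-- The components `c_{αβ i}` of the multiplication by `∂/∂xⁱ` in the basis `∂/∂u^α`. -/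
def flatMul (c : Fin N → Fin N → Fin N → Coord N → ℝ) (u : Fin N → Coord N → ℝ) (i : Fin N)
    (x : Coord N) : Matrix (Fin N) (Fin N) ℝ :=
  ((jacMat u x)⁻¹)ᵀ * mulMat c i x * (jacMat u x)⁻¹

theorem smooth_jac (h : IsFlatFrobeniusOn V g c u η) : SmoothMatOn (jacMat u) V :=
  fun α i => contDiffOn_pd h.isOpen (h.smooth_coord α) i

theorem smooth_jac_inv (h : IsFlatFrobeniusOn V g c u η) : SmoothMatOn (fun y => (jacMat u y)⁻¹) V :=
  h.smooth_jac.inv h.jac_det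

theorem smooth_flatMul (h : IsFlatFrobeniusOn V g c u η) (i : Fin N) :
    SmoothMatOn (flatMul c u i) V :=
  (h.smooth_jac_inv.transpose.mul (h.smooth_mul i)).mul h.smooth_jac_inv

theorem jac_mul_inv (h : IsFlatFrobeniusOn V g c u η) (hx : x ∈ V) :
    jacMat u x * (jacMat u x)⁻¹ = 1 :=
  Matrix.mul_nonsing_inv _ (isUnit_iff_ne_zero.2 (h.jac_det x hx))

theorem inv_mul_jac (h : IsFlatFrobeniusOn V g c u η) (hx : x ∈ V) :
    (jacMat u x)⁻¹ * jacMat u x = 1 :=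
  Matrix.nonsing_inv_mul _ (isUnit_iff_ne_zero.2 (h.jac_det x hx))

theorem jac_transpose_mul_inv (h : IsFlatFrobeniusOn V g c u η) (hx : x ∈ V) :
    (jacMat u x)ᵀ * ((jacMat u x)⁻¹)ᵀ = 1 := by
  rw [← Matrix.transpose_mul, h.inv_mul_jac hx, Matrix.transpose_one]

theorem pdM_jac_inv (h : IsFlatFrobeniusOn V g c u η) (hx : x ∈ V) (l : Fin N) :
    pdM l (fun y => (jacMat u y)⁻¹) x = -(connMat g l x * (jacMat u x)⁻¹) := by
  rw [pdM_of_mul_eq_one h.isOpen h.smooth_jac h.smooth_jac_inv (fun y hy => h.inv_mul_jac hy)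
    (fun y hy => h.jac_mul_inv hy) hx, h.pdM_jac x hx, ← Matrix.mul_assoc, h.inv_mul_jac hx,
    Matrix.one_mul]

theorem flatMul_transpose (h : IsFlatFrobeniusOn V g c u η) (hx : x ∈ V) (i : Fin N) :
    (flatMul c u i x)ᵀ = flatMul c u i x := by
  simp only [flatMul, Matrix.transpose_mul, Matrix.transpose_transpose, h.mul_symm x hx,
    Matrix.mul_assoc]

theorem flatMul_mul_jac (h : IsFlatFrobeniusOn V g c u η) (hx : x ∈ V) (i : Fin N) :
    flatMul c u i x * jacMat u x = ((jacMat u x)⁻¹)ᵀ * mulMat c i x := by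
  rw [flatMul, Matrix.mul_assoc, h.inv_mul_jac hx, Matrix.mul_one]

theorem jac_mul_flatMul (h : IsFlatFrobeniusOn V g c u η) (hx : x ∈ V) (i : Fin N) :
    (jacMat u x)ᵀ * flatMul c u i x = mulMat c i x * (jacMat u x)⁻¹ := by
  rw [flatMul, ← Matrix.mul_assoc, ← Matrix.mul_assoc, h.jac_transpose_mul_inv hx, Matrix.one_mul]

/-- The symmetry of `∇c` says that the forms `∑ᵢ c_{αβ i} dxⁱ` are closed. -/
theorem pdM_flatMul (h : IsFlatFrobeniusOn V g c u η) (hx : x ∈ V) (l i : Fin N) :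
    pdM l (flatMul c u i) x = pdM i (flatMul c u l) x := by
  have key : ∀ l i, pdM l (flatMul c u i) x = ((jacMat u x)⁻¹)ᵀ *
      (pdM l (mulMat c i) x - (connMat g l x)ᵀ * mulMat c i x - mulMat c i x * connMat g l x) *
        (jacMat u x)⁻¹ := by
    intro l i
    have h1 : pdM l (flatMul c u i) x = _ :=
      pdM_mul h.isOpen (h.smooth_jac_inv.transpose.mul (h.smooth_mul i)) h.smooth_jac_inv hx l
    rw [h1, pdM_mul h.isOpen h.smooth_jac_inv.transpose (h.smooth_mul i) hx, pdM_transpose,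
      h.pdM_jac_inv hx, Matrix.transpose_neg, Matrix.transpose_mul]
    noncomm_ring
  rw [key, key]
  congr 2
  ext j k
  have hp := h.potential x hx l i j k
  simp only [covDeriv₃, Finset.sum_add_distrib] at hp
  simp only [Matrix.sub_apply, Matrix.mul_apply, Matrix.transpose_apply, pdM_apply, mulMat_apply,
    connMat_apply]
  simp only [h.conn_symm x hx _ i l] at hp
  simp only [mul_comm (c _ _ _ x)]
  linarith

/-- The associativity equations in flat coordinates. -/
theorem flatMul_assoc (h : IsFlatFrobeniusOn V g c u η) (hx : x ∈ V) (i j : Fin N) :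
    flatMul c u i x * η⁻¹ * flatMul c u j x = flatMul c u j x * η⁻¹ * flatMul c u i x := by
  have hη : (jacMat u x)⁻¹ * η⁻¹ * ((jacMat u x)⁻¹)ᵀ = (g x)⁻¹ := by
    rw [h.metric_eq x hx, Matrix.mul_inv_rev, Matrix.mul_inv_rev, Matrix.transpose_nonsing_inv,
      Matrix.mul_assoc]
  have key : ∀ i j, flatMul c u i x * η⁻¹ * flatMul c u j x =
      ((jacMat u x)⁻¹)ᵀ * (mulMat c i x * (g x)⁻¹ * mulMat c j x) * (jacMat u x)⁻¹ := by
    intro i j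
    rw [← hη]
    simp only [flatMul, Matrix.mul_assoc]
  rw [key, key, h.assoc x hx]

end IsFlatFrobeniusOn

end LocalFrobenius

/-! ### The potential and the moving frame -/

section LocalExistence

open Matrix Metric

namespace IsFlatFrobeniusOn

variable {N : ℕ} {V : Set (Coord N)} {g : Coord N → Matrix (Fin N) (Fin N) ℝ}
  {c : Fin N → Fin N → Fin N → Coord N → ℝ} {u : Fin N → Coord N → ℝ}
  {η : Matrix (Fin N) (Fin N) ℝ} {x : Coord N}

theorem pd_jac (h : IsFlatFrobeniusOn V g c u η) (hx : x ∈ V) (l i α : Fin N) :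
    pd l (pd i (u α)) x = ∑ m, christoffel g m l i x * pd m (u α) x := by
  have := congrFun (congrFun (h.pdM_jac x hx l) α) i
  rw [Matrix.mul_apply] at this
  exact this.trans (Finset.sum_congr rfl fun m _ => mul_comm _ _)

/-- The derivative of a form `∑_α ψ_α du^α`: as the `du^α` are parallel, its covariant derivative
has the components `∑_α ∂ₗψ_α ∂ᵢu^α`. -/
theorem pd_sum_mul_jac (h : IsFlatFrobeniusOn V g c u η) (hx : x ∈ V) {ψ : Fin N → Coord N → ℝ}
    (hψ : ∀ α, ContDiffOn ℝ ∞ (ψ α) V) (l i : Fin N) :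
    pd l (fun y => ∑ α, ψ α y * pd i (u α) y) x =
      ∑ α, pd l (ψ α) x * pd i (u α) x +
        ∑ m, christoffel g m l i x * ∑ α, ψ α x * pd m (u α) x := by
  have hd : ∀ α, DifferentiableAt ℝ (ψ α) x := fun α =>
    differentiableAt_of_contDiffOn h.isOpen (hψ α) hx
  have hd' : ∀ α, DifferentiableAt ℝ (pd i (u α)) x := fun α =>
    h.smooth_jac.differentiableAt h.isOpen hx α i
  rw [pd_sum fun α => (hd α).fun_mul (hd' α)]
  simp only [pd_mul (hd _) (hd' _), Finset.sum_add_distrib, h.pd_jac hx, Finset.mul_sum]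
  congr 1
  rw [Finset.sum_comm]
  exact Finset.sum_congr rfl fun _ _ => Finset.sum_congr rfl fun _ _ => by ring

/-- A form `∑_α ψ_α du^α` is exact if `∑_α ∂ₗψ_α ∂ᵢu^α` is symmetric in `l` and `i`. -/
theorem exists_primitive (h : IsFlatFrobeniusOn V g c u η) {ψ : Fin N → Coord N → ℝ}
    (hψ : ∀ α, ContDiffOn ℝ ∞ (ψ α) V)
    (hs : ∀ x ∈ V, ∀ l i, ∑ α, pd l (ψ α) x * pd i (u α) x = ∑ α, pd i (ψ α) x * pd l (u α) x) :
    ∃ φ : Coord N → ℝ, ContDiffOn ℝ ∞ φ V ∧ ∀ x ∈ V, ∀ i, pd i φ x = ∑ α, ψ α x * pd i (u α) x := by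
  refine exists_potential h.isOpen h.convex (fun i => ContDiffOn.sum fun α _ =>
    (hψ α).mul (contDiffOn_pd h.isOpen (h.smooth_coord α) i)) fun x hx l i => ?_
  rw [h.pd_sum_mul_jac hx hψ, h.pd_sum_mul_jac hx hψ, hs x hx l i]
  simp only [h.conn_symm x hx _ l i]

/-- The multiplication has a potential: `cᵢⱼₖ = ∇ᵢ∇ⱼ∇ₖΦ`. -/
theorem exists_covThird_eq (h : IsFlatFrobeniusOn V g c u η) :
    ∃ Φ : Coord N → ℝ, ContDiffOn ℝ ∞ Φ V ∧
      ∀ x ∈ V, ∀ i j k, covThird g Φ i j k x = c i j k x := by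
  have h2 : ∀ α β, ∃ f : Coord N → ℝ, ContDiffOn ℝ ∞ f V ∧
      ∀ x ∈ V, ∀ i, pd i f x = flatMul c u i x α β := fun α β =>
    exists_potential h.isOpen h.convex (fun i => h.smooth_flatMul i α β) fun x hx i j =>
      congrFun (congrFun (h.pdM_flatMul hx i j) α) β
  choose f hfs hf using h2
  -- `f α β` and `f β α` differ by a constant; the mean of the two is symmetric
  let φ : Coord N → Matrix (Fin N) (Fin N) ℝ := fun x =>
    Matrix.of fun α β => (1 / 2 : ℝ) * (f α β x + f β α x)
  have hφs : SmoothMatOn φ V := fun α β => contDiffOn_const.mul ((hfs α β).add (hfs β α))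
  have hφt : ∀ y, (φ y)ᵀ = φ y := fun y => by
    ext α β
    simp only [φ, Matrix.transpose_apply, Matrix.of_apply, add_comm]
  have hφ : ∀ x ∈ V, ∀ i, pdM i φ x = flatMul c u i x := by
    intro x hx i
    have hd : ∀ α β, DifferentiableAt ℝ (f α β) x := fun α β =>
      differentiableAt_of_contDiffOn h.isOpen (hfs α β) hx
    ext α β
    change pd i (fun y => (1 / 2 : ℝ) * (f α β y + f β α y)) x = _
    rw [pd_const_mul ((hd α β).fun_add (hd β α)), pd_add (hd α β) (hd β α), hf _ _ x hx, hf _ _ x hx]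
    have := congrFun (congrFun (h.flatMul_transpose hx i) α) β
    rw [Matrix.transpose_apply] at this
    rw [this]
    ring
  have h1 : ∀ α, ∃ ψ : Coord N → ℝ, ContDiffOn ℝ ∞ ψ V ∧
      ∀ x ∈ V, ∀ i, pd i ψ x = ∑ β, φ x α β * pd i (u β) x := by
    intro α
    refine h.exists_primitive (fun β => hφs α β) fun x hx l i => ?_
    have e : ∀ l i, ∑ β, pd l (fun y => φ y α β) x * pd i (u β) x =
        (((jacMat u x)⁻¹)ᵀ * mulMat c l x) α i := by
      intro l i
      rw [← h.flatMul_mul_jac hx, ← hφ x hx]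
      rfl
    rw [e, e]
    simp only [Matrix.mul_apply, mulMat_apply]
    refine Finset.sum_congr rfl fun k _ => ?_
    have := congrFun (congrFun (h.mul_symm x hx l) i) k
    rw [Matrix.transpose_apply, mulMat_apply, mulMat_apply] at this
    have h' := congrFun (congrFun (h.mul_symm x hx i) k) l
    rw [Matrix.transpose_apply, mulMat_apply, mulMat_apply] at h'
    rw [this, h.mul_swap x hx l i k, h']
  choose ψ hψs hψ using h1
  obtain ⟨Φ, hΦs, hΦ⟩ := h.exists_primitive hψs (by
    intro x hx l i
    simp only [fun α => hψ α x hx, Finset.sum_mul]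
    rw [Finset.sum_comm]
    refine Finset.sum_congr rfl fun α _ => Finset.sum_congr rfl fun β _ => ?_
    rw [← congrFun (congrFun (hφt x) α) β, Matrix.transpose_apply]
    ring)
  have hHess : ∀ x ∈ V, ∀ j k, covHess g Φ j k x = ((jacMat u x)ᵀ * φ x * jacMat u x) j k := by
    intro x hx j k
    rw [covHess, pd_congr h.isOpen (fun y hy => hΦ y hy k) hx, h.pd_sum_mul_jac hx hψs]
    simp only [hΦ x hx, add_sub_cancel_right, fun α => hψ α x hx, Finset.sum_mul, Matrix.mul_apply,
      Matrix.transpose_apply, jacMat_apply]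
    refine Finset.sum_congr rfl fun α _ => Finset.sum_congr rfl fun β _ => ?_
    rw [← congrFun (congrFun (hφt x) α) β, Matrix.transpose_apply]
    ring
  refine ⟨Φ, hΦs, fun x hx i j k => ?_⟩
  have hJ := h.smooth_jac
  have hmat : pdM i (fun y => (jacMat u y)ᵀ * φ y * jacMat u y) x =
      (connMat g i x)ᵀ * ((jacMat u x)ᵀ * φ x * jacMat u x) + mulMat c i x +
        ((jacMat u x)ᵀ * φ x * jacMat u x) * connMat g i x := by
    rw [pdM_mul h.isOpen (hJ.transpose.mul hφs) hJ hx, pdM_mul h.isOpen hJ.transpose hφs hx,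
      pdM_transpose, h.pdM_jac x hx, hφ x hx, Matrix.transpose_mul]
    have : (jacMat u x)ᵀ * flatMul c u i x * jacMat u x = mulMat c i x := by
      rw [h.jac_mul_flatMul hx, Matrix.mul_assoc, h.inv_mul_jac hx, Matrix.mul_one]
    rw [← this]
    noncomm_ring
  have hmat' := congrFun (congrFun hmat j) k
  rw [covThird, pd_congr h.isOpen (fun y hy => hHess y hy j k) hx]
  change pd i (fun y => ((jacMat u y)ᵀ * φ y * jacMat u y) j k) x = _ at hmat'
  rw [hmat']
  simp only [hHess x hx, Finset.sum_add_distrib]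
  rw [Matrix.add_apply, Matrix.add_apply, Matrix.mul_apply, Matrix.mul_apply (N := connMat g i x)]
  simp only [Matrix.transpose_apply, connMat_apply, mulMat_apply]
  simp only [mul_comm (((jacMat u x)ᵀ * φ x * jacMat u x) j _)]
  ring

/-- The moving frame of the submanifold: `P` has the rows `e_α = ∂r/∂u^α` and `Q` has as rows the
normals `n_α`. The system is integrable because the forms `c_{αβ i} dxⁱ` are closed and by the
associativity equations. Its matrix is skew with respect to `diag(η, κη)`, so that a frame which has
this Gram matrix at one point has it everywhere. -/
theorem exists_frame (h : IsFlatFrobeniusOn V g c u η) {κ : ℝ} (hκ : κ ≠ 0) {x₀ : Coord N}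
    (hx₀ : x₀ ∈ V) :
    ∃ s ≤ 2 * N, ∃ ρ > 0, ball x₀ ρ ⊆ V ∧ ∃ P Q : Coord N → Matrix (Fin N) (Fin (2 * N)) ℝ,
      SmoothMatOn P (ball x₀ ρ) ∧ SmoothMatOn Q (ball x₀ ρ) ∧
      ∀ x ∈ ball x₀ ρ,
        (∀ i, pdM i P x = κ⁻¹ • (flatMul c u i x * η⁻¹ * Q x)) ∧
        (∀ i, pdM i Q x = -(flatMul c u i x * η⁻¹ * P x)) ∧
        P x * signMat (2 * N) s * (P x)ᵀ = η ∧ P x * signMat (2 * N) s * (Q x)ᵀ = 0 ∧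
        Q x * signMat (2 * N) s * (Q x)ᵀ = κ • η := by
  have hηi : η * η⁻¹ = 1 := Matrix.mul_nonsing_inv _ (isUnit_iff_ne_zero.2 h.metric_det)
  have hηit : (η⁻¹)ᵀ = η⁻¹ := by rw [Matrix.transpose_nonsing_inv, h.metric_symm]
  let B : Fin N → Coord N → Matrix (Fin N) (Fin N) ℝ := fun i x => flatMul c u i x * η⁻¹
  have hB : ∀ i, SmoothMatOn (B i) V := fun i => (h.smooth_flatMul i).mul (.const _)
  let A : Fin N → Coord N → Matrix (Fin N ⊕ Fin N) (Fin N ⊕ Fin N) ℝ := fun i x =>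
    Matrix.fromBlocks 0 (κ⁻¹ • B i x) (-B i x) 0
  let G : Matrix (Fin N ⊕ Fin N) (Fin N ⊕ Fin N) ℝ := Matrix.fromBlocks η 0 0 (κ • η)
  let G' : Matrix (Fin N ⊕ Fin N) (Fin N ⊕ Fin N) ℝ := Matrix.fromBlocks η⁻¹ 0 0 (κ⁻¹ • η⁻¹)
  have hGG' : G * G' = 1 := by
    simp [G, G', Matrix.fromBlocks_multiply, hηi, smul_smul, hκ]
  have hGt : Gᵀ = G := by
    simp [G, Matrix.fromBlocks_transpose, h.metric_symm]
  have hGdet : G.det ≠ 0 := by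
    intro h0
    have := congrArg Matrix.det hGG'
    rw [Matrix.det_mul, h0, zero_mul, Matrix.det_one] at this
    exact zero_ne_one this
  obtain ⟨s, hs, E₀, hE₀⟩ := exists_mul_signMat_mul_transpose (m := 2 * N)
    (by simp [two_mul]) hGt hGdet
  obtain ⟨ρ, hρ, hρV, E, hE0, hEs, hE⟩ := exists_solution_matrix_system (A := A) h.isOpen hx₀
    (fun i => .fromBlocks (.const 0) ((hB i).smul _) (hB i).neg (.const 0)) (by
      intro x hx i j
      have hd : ∀ i j, pdM i (A j) x = Matrix.fromBlocks 0
          (κ⁻¹ • (pdM i (flatMul c u j) x * η⁻¹)) (-(pdM i (flatMul c u j) x * η⁻¹)) 0 := by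
        intro i j
        have h1 : pdM i (B j) x = pdM i (flatMul c u j) x * η⁻¹ :=
          pdM_mul_const h.isOpen (h.smooth_flatMul j) hx _ i
        have h2 := pdM_smul h.isOpen (hB j) hx κ⁻¹ i
        have h3 := pdM_smul h.isOpen (hB j) hx (-1) i
        rw [h1] at h2 h3
        simp only [neg_smul, one_smul] at h3
        rw [← h2, ← h3]
        ext (a | a) (b | b)
        · exact pd_const i 0 x
        · rfl
        · rfl
        · exact pd_const i 0 x
      have hm : ∀ i j, A j x * A i x = Matrix.fromBlocks (-(κ⁻¹ • (B j x * B i x))) 0 0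
          (-(κ⁻¹ • (B j x * B i x))) := by
        intro i j
        simp [A, Matrix.fromBlocks_multiply]
      have hc : B j x * B i x = B i x * B j x := by
        have := congrArg (· * η⁻¹) (h.flatMul_assoc hx j i)
        simpa [B, Matrix.mul_assoc] using this
      rw [hd, hd, hm, hm, h.pdM_flatMul hx, hc]) E₀
  have hx₀B : x₀ ∈ ball x₀ ρ := mem_ball_self hρ
  -- the dual Gram matrix is constant along the solution
  obtain ⟨T, hT⟩ := exists_eq_const_of_pdM_eq_zero (M := fun y => (E y)ᵀ * G' * E y) isOpen_ball
    (convex_ball x₀ ρ).isPreconnected ((hEs.transpose.mul (.const G')).mul hEs) (by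
      intro x hx i
      rw [pdM_mul isOpen_ball (hEs.transpose.mul (.const G')) hEs hx,
        pdM_mul_const isOpen_ball hEs.transpose hx, pdM_transpose, hE x hx]
      have : (A i x)ᵀ * G' + G' * A i x = 0 := by
        have hBt : (B i x)ᵀ * η⁻¹ = η⁻¹ * B i x := by
          simp only [B, Matrix.transpose_mul, hηit, h.flatMul_transpose (hρV hx), Matrix.mul_assoc]
        simp [A, G', Matrix.fromBlocks_transpose, Matrix.fromBlocks_multiply, hBt,
          Matrix.fromBlocks_add]
      calc (A i x * E x)ᵀ * G' * E x + (E x)ᵀ * G' * (A i x * E x)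
          = (E x)ᵀ * ((A i x)ᵀ * G' + G' * A i x) * E x := by
            rw [Matrix.transpose_mul]
            simp only [Matrix.mul_add, Matrix.add_mul, Matrix.mul_assoc]
        _ = 0 := by rw [this, Matrix.mul_zero, Matrix.zero_mul])
  have hcard : Fintype.card (Fin N ⊕ Fin N) = Fintype.card (Fin (2 * N)) := by simp [two_mul]
  have hTs : T * signMat (2 * N) s = 1 := by
    rw [← hT x₀ hx₀B, hE0, Matrix.mul_assoc,
      Matrix.mul_eq_one_comm_of_card_eq _ _ _ hcard.symm, ← Matrix.mul_assoc, hE₀, hGG']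
  have hGram : ∀ x ∈ ball x₀ ρ, E x * signMat (2 * N) s * (E x)ᵀ = G := by
    intro x hx
    have h1 : (E x)ᵀ * G' * (E x * signMat (2 * N) s) = 1 := by
      rw [← Matrix.mul_assoc, hT x hx, hTs]
    rw [Matrix.mul_eq_one_comm_of_card_eq _ _ _ hcard.symm, ← Matrix.mul_assoc] at h1
    have h2 := congrArg (· * G) h1
    simpa [Matrix.mul_assoc, mul_eq_one_comm.1 hGG'] using h2
  refine ⟨s, hs, ρ, hρ, hρV, fun x => Matrix.of fun a => E x (Sum.inl a),
    fun x => Matrix.of fun a => E x (Sum.inr a), fun a b => hEs _ _, fun a b => hEs _ _,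
    fun x hx => ?_⟩
  have entry : ∀ a b, (E x * signMat (2 * N) s * (E x)ᵀ) a b = G a b := fun a b => by
    rw [hGram x hx]
  simp only [mul_signMat_mul_transpose_apply] at entry
  have dentry : ∀ i a b, pd i (fun y => E y a b) x = (A i x * E x) a b := fun i a b =>
    congrFun (congrFun (hE x hx i) a) b
  refine ⟨fun i => ?_, fun i => ?_, ?_, ?_, ?_⟩
  · ext a b
    refine (dentry i _ _).trans ?_
    simp [A, B, Matrix.mul_apply, ← Finset.mul_sum, mul_assoc]
  · ext a b
    refine (dentry i _ _).trans ?_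
    simp [A, B, Matrix.mul_apply]
  · ext a b
    rw [mul_signMat_mul_transpose_apply]
    exact entry (Sum.inl a) (Sum.inl b)
  · ext a b
    rw [mul_signMat_mul_transpose_apply]
    exact entry (Sum.inl a) (Sum.inr b)
  · ext a b
    rw [mul_signMat_mul_transpose_apply]
    exact entry (Sum.inr a) (Sum.inr b)

end IsFlatFrobeniusOn

end LocalExistence

/-! ### Immersions are locally embeddings -/

section Immersion

open Metric

/-- A smooth map whose differential at `x₀` is injective is an embedding near `x₀`. -/
theorem exists_isEmbedding_domRestrict {X F : Type*} [NormedAddCommGroup X] [NormedSpace ℝ X]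
    [FiniteDimensional ℝ X] [NormedAddCommGroup F] [NormedSpace ℝ F] [FiniteDimensional ℝ F]
    {V : Set X} (hV : IsOpen V) {f : X → F} (hf : ContDiffOn ℝ ∞ f V) {x₀ : X} (hx₀ : x₀ ∈ V)
    (hinj : Function.Injective (fderiv ℝ f x₀)) :
    ∃ ρ > 0, ball x₀ ρ ⊆ V ∧ ∀ ρ' ≤ ρ, Topology.IsEmbedding ((ball x₀ ρ').domRestrict f) := by
  have : CompleteSpace X := FiniteDimensional.complete ℝ X
  obtain ⟨L, hL⟩ := (fderiv ℝ f x₀).toLinearMap.exists_leftInverse_of_injective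
    (LinearMap.ker_eq_bot.2 hinj)
  let L' : F →L[ℝ] X := LinearMap.toContinuousLinearMap L
  have hst : HasStrictFDerivAt f (fderiv ℝ f x₀) x₀ :=
    (hf.contDiffAt (hV.mem_nhds hx₀)).hasStrictFDerivAt (by simp)
  have hcomp : HasStrictFDerivAt (L' ∘ f) (ContinuousLinearEquiv.refl ℝ X : X →L[ℝ] X) x₀ := by
    have h1 := L'.hasStrictFDerivAt.comp x₀ hst
    have h2 : L'.comp (fderiv ℝ f x₀) = (ContinuousLinearEquiv.refl ℝ X : X →L[ℝ] X) := by
      ext v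
      exact LinearMap.congr_fun hL v
    rwa [h2] at h1
  let e := hcomp.toOpenPartialHomeomorph (L' ∘ f)
  have he : x₀ ∈ e.source := hcomp.mem_toOpenPartialHomeomorph_source
  obtain ⟨ρ, hρ, hB⟩ := Metric.isOpen_iff.1 (hV.inter e.open_source) x₀ ⟨hx₀, he⟩
  refine ⟨ρ, hρ, fun x hx => (hB hx).1, fun ρ' hρ' => ?_⟩
  have hB' : ball x₀ ρ' ⊆ V ∩ e.source := (ball_subset_ball hρ').trans hB
  refine Topology.IsEmbedding.of_comp
    (continuousOn_iff_continuous_domRestrict.1 (hf.continuousOn.mono fun x hx => (hB' hx).1))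
    L'.continuous ?_
  exact e.isOpenEmbedding_restrict.isEmbedding.comp
    (Topology.IsEmbedding.inclusion fun x hx => (hB' hx).2)

end Immersion

/-! ### Realization by a submanifold -/

section LocalRealization

open Matrix Metric

variable {N m s : ℕ}

theorem pseudoInner_comm (x y : EuclideanSpace ℝ (Fin m)) :
    pseudoInner s x y = pseudoInner s y x := by
  simp only [pseudoInner]
  exact Finset.sum_congr rfl fun a _ => by ring

/-- The linear form `(x, ·)`. -/
def pseudoInnerLeft (s : ℕ) (x : EuclideanSpace ℝ (Fin m)) : EuclideanSpace ℝ (Fin m) →ₗ[ℝ] ℝ where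
  toFun := pseudoInner s x
  map_add' y z := by simp [pseudoInner, mul_add, Finset.sum_add_distrib]
  map_smul' a y := by simp [pseudoInner, Finset.mul_sum, mul_left_comm]

theorem contDiffOn_toLp {ι : Type*} {M : Coord N → Matrix ι (Fin m) ℝ} {V : Set (Coord N)}
    (hM : SmoothMatOn M V) (a : ι) : ContDiffOn ℝ ∞ (fun y => WithLp.toLp 2 (M y a)) V :=
  contDiffOn_euclidean.2 fun p => hM a p

theorem pd_toLp {ι : Type*} {M : Coord N → Matrix ι (Fin m) ℝ} {V : Set (Coord N)}
    (hV : IsOpen V) (hM : SmoothMatOn M V) {x : Coord N} (hx : x ∈ V) (i : Fin N) (a : ι) :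
    pd i (fun y => WithLp.toLp 2 (M y a)) x = WithLp.toLp 2 (pdM i M x a) := by
  ext p
  rw [pd_coord (differentiableAt_of_contDiffOn hV (contDiffOn_toLp hM a) hx)]
  rfl

/-- A matrix of basis components of partial derivatives with nonzero determinant forces the
differential to be injective. -/
theorem fderiv_injective_of_det_ne_zero {F : Type*} [NormedAddCommGroup F] [NormedSpace ℝ F]
    {f : Coord N → F} {x : Coord N} (L : Fin N → F →ₗ[ℝ] ℝ)
    (h : (Matrix.of fun a i => L a (pd i f x)).det ≠ 0) : Function.Injective (fderiv ℝ f x) := by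
  rw [injective_iff_map_eq_zero]
  intro v hv
  have : (Matrix.of fun a i => L a (pd i f x)) *ᵥ (fun i => v i) = 0 := by
    ext a
    have h1 := congrArg (L a) hv
    rw [fderiv_apply_eq_sum_pd] at h1
    simpa [Matrix.mulVec, dotProduct, mul_comm] using h1
  have := Matrix.eq_zero_of_mulVec_eq_zero h this
  ext i
  exact congrFun this i

theorem christoffel_congr {V : Set (Coord N)} (hV : IsOpen V)
    {g g' : Coord N → Matrix (Fin N) (Fin N) ℝ} (hg : ∀ x ∈ V, g x = g' x) {x : Coord N}
    (hx : x ∈ V) (k i j : Fin N) : christoffel g k i j x = christoffel g' k i j x := by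
  have hp : ∀ l a b, pd l (fun y => g y a b) x = pd l (fun y => g' y a b) x := fun l a b =>
    pd_congr hV (fun y hy => by rw [hg y hy]) hx l
  simp only [christoffel, hp, hg x hx]

theorem curvature_congr {V : Set (Coord N)} (hV : IsOpen V)
    {g g' : Coord N → Matrix (Fin N) (Fin N) ℝ} (hg : ∀ x ∈ V, g x = g' x) {x : Coord N}
    (hx : x ∈ V) (l k i j : Fin N) : curvature g l k i j x = curvature g' l k i j x := by
  simp only [curvature, pd_congr hV (fun y hy => christoffel_congr hV hg hy _ _ _) hx,
    christoffel_congr hV hg hx]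

theorem covThird_congr {V : Set (Coord N)} (hV : IsOpen V)
    {g g' : Coord N → Matrix (Fin N) (Fin N) ℝ} (hg : ∀ x ∈ V, g x = g' x) (Φ : Coord N → ℝ)
    {x : Coord N} (hx : x ∈ V) (i j k : Fin N) :
    covThird g Φ i j k x = covThird g' Φ i j k x := by
  have hH : ∀ y ∈ V, ∀ j k, covHess g Φ j k y = covHess g' Φ j k y := fun y hy j k => by
    simp only [covHess, christoffel_congr hV hg hy]
  simp only [covThird, pd_congr hV (fun y hy => hH y hy _ _) hx, hH x hx,
    christoffel_congr hV hg hx]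

namespace IsFlatFrobeniusOn

variable {V : Set (Coord N)} {g : Coord N → Matrix (Fin N) (Fin N) ℝ}
  {c : Fin N → Fin N → Fin N → Coord N → ℝ} {u : Fin N → Coord N → ℝ}
  {η : Matrix (Fin N) (Fin N) ℝ} {x : Coord N}

theorem mono (h : IsFlatFrobeniusOn V g c u η) {V' : Set (Coord N)} (ho : IsOpen V')
    (hc : Convex ℝ V') (hV : V' ⊆ V) : IsFlatFrobeniusOn V' g c u η where
  isOpen := ho
  convex := hc
  smooth_conn l := (h.smooth_conn l).mono hV
  conn_symm x hx := h.conn_symm x (hV hx)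
  smooth_mul i := (h.smooth_mul i).mono hV
  mul_symm x hx := h.mul_symm x (hV hx)
  mul_swap x hx := h.mul_swap x (hV hx)
  assoc x hx := h.assoc x (hV hx)
  potential x hx := h.potential x (hV hx)
  smooth_coord α := (h.smooth_coord α).mono hV
  jac_det x hx := h.jac_det x (hV hx)
  pdM_jac x hx := h.pdM_jac x (hV hx)
  metric_symm := h.metric_symm
  metric_det := h.metric_det
  metric_eq x hx := h.metric_eq x (hV hx)

theorem det_metric_ne_zero (h : IsFlatFrobeniusOn V g c u η) (hx : x ∈ V) : (g x).det ≠ 0 := by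
  rw [h.metric_eq x hx, Matrix.det_mul, Matrix.det_mul, Matrix.det_transpose]
  exact mul_ne_zero (mul_ne_zero (h.jac_det x hx) h.metric_det) (h.jac_det x hx)

/-- Given a moving frame `(e_α, n_α)`, the rows of `P` and `Q`, the equation `dr = ∑_α e_α du^α` is
solvable, because the `cᵢⱼₖ` are symmetric. -/
theorem exists_immersion (h : IsFlatFrobeniusOn V g c u η) {κ : ℝ}
    {P Q : Coord N → Matrix (Fin N) (Fin m) ℝ} (hP : SmoothMatOn P V)
    (hdP : ∀ x ∈ V, ∀ i, pdM i P x = κ⁻¹ • (flatMul c u i x * η⁻¹ * Q x)) :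
    ∃ r : Coord N → EuclideanSpace ℝ (Fin m), ContDiffOn ℝ ∞ r V ∧
      ∀ x ∈ V, ∀ i, pd i r x = WithLp.toLp 2 (((jacMat u x)ᵀ * P x) i) := by
  have hr : ∀ p, ∃ f : Coord N → ℝ, ContDiffOn ℝ ∞ f V ∧
      ∀ x ∈ V, ∀ i, pd i f x = ∑ α, P x α p * pd i (u α) x := by
    intro p
    refine h.exists_primitive (fun α => hP α p) fun x hx l i => ?_
    have e : ∀ l i, ∑ α, pd l (fun y => P y α p) x * pd i (u α) x =
        κ⁻¹ * ∑ k, c l i k x * ((jacMat u x)⁻¹ * (η⁻¹ * Q x)) k p := by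
      intro l i
      have : ((jacMat u x)ᵀ * pdM l P x) =
          κ⁻¹ • (mulMat c l x * ((jacMat u x)⁻¹ * (η⁻¹ * Q x))) := by
        rw [hdP x hx, Matrix.mul_smul, Matrix.mul_assoc, ← Matrix.mul_assoc,
          h.jac_mul_flatMul hx, Matrix.mul_assoc]
      have := congrFun (congrFun this i) p
      rw [Matrix.smul_apply, Matrix.mul_apply, Matrix.mul_apply, smul_eq_mul] at this
      rw [show ∑ k, c l i k x * ((jacMat u x)⁻¹ * (η⁻¹ * Q x)) k p =
        ∑ k, mulMat c l x i k * ((jacMat u x)⁻¹ * (η⁻¹ * Q x)) k p from rfl, ← this]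
      exact Finset.sum_congr rfl fun α _ => mul_comm _ _
    rw [e, e]
    simp only [h.mul_swap x hx l i]
  choose f hfs hf using hr
  have hrs : ContDiffOn ℝ ∞ (fun x => WithLp.toLp 2 fun p => f p x) V :=
    contDiffOn_euclidean.2 fun p => hfs p
  refine ⟨fun x => WithLp.toLp 2 fun p => f p x, hrs, fun x hx i => ?_⟩
  ext p
  rw [pd_coord (differentiableAt_of_contDiffOn h.isOpen hrs hx)]
  refine (hf p x hx i).trans ?_
  simp [Matrix.mul_apply, mul_comm]

/-- A Frobenius structure with flat coordinates `u` on an open set is realized, near every point, by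
an embedded potential flat torsionless submanifold with normals of Gram matrix `κη`. -/
theorem exists_submanifold (h : IsFlatFrobeniusOn V g c u η) (hflat : IsFlatOn g V) {κ : ℝ}
    (hκ : κ ≠ 0) {x₀ : Coord N} (hx₀ : x₀ ∈ V) :
    ∃ s ≤ 2 * N, ∃ ρ > 0, ball x₀ ρ ⊆ V ∧ ∃ (r : Coord N → EuclideanSpace ℝ (Fin (2 * N)))
      (ν : Fin N → Coord N → EuclideanSpace ℝ (Fin (2 * N))),
      IsPotentialFlatTorsionlessOn s (ball x₀ ρ) r ν (κ • η) u η ∧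
      (∀ x ∈ ball x₀ ρ, firstForm s r x = g x) ∧
      (∀ x ∈ ball x₀ ρ, ∀ i j k, secondForms s r ν u i j k x = c i j k x) ∧
      Set.InjOn (fun x α => u α x) (ball x₀ ρ) ∧
      Topology.IsEmbedding ((ball x₀ ρ).domRestrict r) := by
  obtain ⟨s, hs, ρ₁, hρ₁, hB₁, P, Q, hP, hQ, hframe⟩ := h.exists_frame hκ hx₀
  have h₁ := h.mono isOpen_ball (convex_ball x₀ ρ₁) hB₁
  have hηi : η * η⁻¹ = 1 := Matrix.mul_nonsing_inv _ (isUnit_iff_ne_zero.2 h.metric_det)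
  have hηit : (η⁻¹)ᵀ = η⁻¹ := by rw [Matrix.transpose_nonsing_inv, h.metric_symm]
  obtain ⟨r, hrs, hr⟩ := h₁.exists_immersion hP fun x hx => (hframe x hx).1
  have hx₁ : x₀ ∈ ball x₀ ρ₁ := mem_ball_self hρ₁
  let ν : Fin N → Coord N → EuclideanSpace ℝ (Fin (2 * N)) := fun α x => WithLp.toLp 2 (Q x α)
  have hJP : SmoothMatOn (fun y => (jacMat u y)ᵀ * P y) (ball x₀ ρ₁) := h₁.smooth_jac.transpose.mul hP
  have hfirst : ∀ x ∈ ball x₀ ρ₁, firstForm s r x = g x := by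
    intro x hx
    have : firstForm s r x = ((jacMat u x)ᵀ * P x) * signMat (2 * N) s * ((jacMat u x)ᵀ * P x)ᵀ := by
      ext i j
      rw [mul_signMat_mul_transpose_apply, firstForm, Matrix.of_apply, hr x hx, hr x hx]
    rw [this, h₁.metric_eq x hx, ← (hframe x hx).2.2.1, Matrix.transpose_mul,
      Matrix.transpose_transpose]
    simp only [Matrix.mul_assoc]
  have hrank : ∀ x ∈ ball x₀ ρ₁, Function.Injective (fderiv ℝ r x) := by
    intro x hx
    refine fderiv_injective_of_det_ne_zero (fun a => pseudoInnerLeft s (pd a r x)) ?_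
    have := h₁.det_metric_ne_zero hx
    rw [← hfirst x hx] at this
    exact this
  have hus : ContDiffOn ℝ ∞ (fun x α => u α x) (ball x₀ ρ₁) := contDiffOn_pi.2 h₁.smooth_coord
  have hinju : Function.Injective (fderiv ℝ (fun x α => u α x) x₀) := by
    refine fderiv_injective_of_det_ne_zero (fun a => LinearMap.proj a) ?_
    have : (Matrix.of fun a i => (LinearMap.proj a : (Fin N → ℝ) →ₗ[ℝ] ℝ)
        (pd i (fun x α => u α x) x₀)) = jacMat u x₀ := by
      ext a i
      have hd := hasFDerivAt_pi.2 fun α =>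
        (differentiableAt_of_contDiffOn isOpen_ball (h₁.smooth_coord α) hx₁).hasFDerivAt
      simp [pd, hd.fderiv]
    rw [this]
    exact h₁.jac_det x₀ hx₁
  obtain ⟨ρ₂, hρ₂, hB₂, hemb⟩ := exists_isEmbedding_domRestrict isOpen_ball hrs hx₁ (hrank x₀ hx₁)
  obtain ⟨ρ₃, hρ₃, hB₃, hembu⟩ := exists_isEmbedding_domRestrict isOpen_ball hus hx₁ hinju
  have hρsub : ball x₀ (min ρ₂ ρ₃) ⊆ ball x₀ ρ₁ := (ball_subset_ball (min_le_left _ _)).trans hB₂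
  have hsecond : ∀ x ∈ ball x₀ ρ₁, ∀ i j k, secondForms s r ν u i j k x = c i j k x := by
    intro x hx i j k
    have hpd : pd j (pd k r) x = WithLp.toLp 2 (pdM j (fun y => (jacMat u y)ᵀ * P y) x k) := by
      rw [pd_congr isOpen_ball (fun y hy => hr y hy k) hx]
      exact pd_toLp isOpen_ball hJP hx j k
    have hm : pdM j (fun y => (jacMat u y)ᵀ * P y) x = (connMat g j x)ᵀ * (jacMat u x)ᵀ * P x +
        κ⁻¹ • (mulMat c j x * (jacMat u x)⁻¹ * η⁻¹ * Q x) := by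
      rw [pdM_mul isOpen_ball h₁.smooth_jac.transpose hP hx, pdM_transpose, h₁.pdM_jac x hx,
        (hframe x hx).1, Matrix.transpose_mul, Matrix.mul_smul, ← h₁.jac_mul_flatMul hx]
      simp only [Matrix.mul_assoc]
    have hQP : Q x * signMat (2 * N) s * (P x)ᵀ = 0 := by
      have := congrArg Matrix.transpose (hframe x hx).2.2.2.1
      simpa [Matrix.transpose_mul, signMat_transpose, Matrix.mul_assoc] using this
    have hω : (jacMat u x)ᵀ *
        (Q x * signMat (2 * N) s * (pdM j (fun y => (jacMat u y)ᵀ * P y) x)ᵀ) = mulMat c j x := by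
      have e1 : Q x * signMat (2 * N) s * (pdM j (fun y => (jacMat u y)ᵀ * P y) x)ᵀ =
          (Q x * signMat (2 * N) s * (P x)ᵀ) * ((connMat g j x)ᵀ * (jacMat u x)ᵀ)ᵀ +
          κ⁻¹ • ((Q x * signMat (2 * N) s * (Q x)ᵀ) *
            (mulMat c j x * (jacMat u x)⁻¹ * η⁻¹)ᵀ) := by
        rw [hm, Matrix.transpose_add, Matrix.transpose_smul, Matrix.transpose_mul _ (P x),
          Matrix.transpose_mul _ (Q x), Matrix.mul_add, Matrix.mul_smul]
        simp only [Matrix.mul_assoc]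
      rw [e1, hQP, (hframe x hx).2.2.2.2, Matrix.zero_mul, zero_add, Matrix.transpose_mul,
        Matrix.transpose_mul, hηit, h₁.mul_symm x hx, Matrix.smul_mul, smul_smul,
        inv_mul_cancel₀ hκ, one_smul, ← Matrix.mul_assoc η, hηi, Matrix.one_mul,
        ← Matrix.mul_assoc, h₁.jac_transpose_mul_inv hx, Matrix.one_mul]
    have hω' := congrFun (congrFun hω i) k
    rw [Matrix.mul_apply] at hω'
    rw [h₁.mul_swap x hx i j k, secondForms]
    refine Eq.trans (Finset.sum_congr rfl fun α _ => ?_) hω'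
    rw [mul_signMat_mul_transpose_apply, secondForm, hpd]
    rfl
  refine ⟨s, hs, min ρ₂ ρ₃, by positivity, hρsub.trans hB₁, r, ν, ?_, fun x hx => hfirst x (hρsub hx),
    fun x hx => hsecond x (hρsub hx), ?_, hemb _ (min_le_left _ _)⟩
  · have hgf : ∀ x ∈ ball x₀ (min ρ₂ ρ₃), firstForm s r x = g x := fun x hx => hfirst x (hρsub hx)
    refine ⟨⟨hrs.mono hρsub, fun x hx => hrank x (hρsub hx), fun x hx => ?_⟩, fun x hx l k i j => ?_,
      ⟨fun α => (contDiffOn_toLp hQ α).mono hρsub, fun x hx α i => ?_, fun x hx α β => ?_, ?_,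
        fun x hx α β i => ?_⟩,
      ⟨fun α => (h₁.smooth_coord α).mono hρsub, fun x hx => h₁.jac_det x (hρsub hx),
        fun x hx i j => ?_⟩, ?_⟩
    · rw [hgf x hx]
      exact h₁.det_metric_ne_zero (hρsub hx)
    · rw [curvature_congr isOpen_ball hgf hx]
      exact hflat x (hB₁ (hρsub hx)) l k i j
    · have := (hframe x (hρsub hx)).2.2.2.1
      rw [hr x (hρsub hx), pseudoInner_comm, ← mul_signMat_mul_transpose_apply, Matrix.mul_assoc,
        Matrix.mul_assoc, ← Matrix.mul_assoc (P x), this, Matrix.mul_zero, Matrix.zero_apply]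
    · rw [← (hframe x (hρsub hx)).2.2.2.2, mul_signMat_mul_transpose_apply]
    · rw [Matrix.det_smul]
      exact mul_ne_zero (pow_ne_zero _ hκ) h.metric_det
    · have h1 : pd i (ν α) x = WithLp.toLp 2 (pdM i Q x α) := pd_toLp isOpen_ball hQ (hρsub hx) i α
      rw [h1, ← mul_signMat_mul_transpose_apply, (hframe x (hρsub hx)).2.1, Matrix.neg_mul,
        Matrix.neg_mul, Matrix.mul_assoc _ (P x), Matrix.mul_assoc _ (P x * _),
        (hframe x (hρsub hx)).2.2.2.1, Matrix.mul_zero, neg_zero, Matrix.zero_apply]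
    · rw [hgf x hx, h₁.metric_eq x (hρsub hx), Matrix.mul_apply]
      simp only [Matrix.mul_apply, Matrix.transpose_apply, jacMat_apply, Finset.sum_mul]
      rw [Finset.sum_comm]
      exact Finset.sum_congr rfl fun α _ => Finset.sum_congr rfl fun β _ => by ring
    · obtain ⟨Φ, hΦs, hΦ⟩ := h₁.exists_covThird_eq
      refine ⟨Φ, hΦs.mono hρsub, fun x hx i j k => ?_⟩
      rw [hsecond x (hρsub hx), covThird_congr isOpen_ball hgf Φ hx, hΦ x (hρsub hx)]
  · exact Set.injOn_iff_injective.2 (hembu _ (min_le_right _ _)).injective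

end IsFlatFrobeniusOn

end LocalRealization

/-! ### Uniqueness up to motions -/

section Uniqueness

open Matrix

variable {N m : ℕ}

/-- The Christoffel symbols of the first kind are determined by the metric. -/
theorem eq_half_sum_of_symm {b : Fin N → Fin N → Fin N → ℝ} {d : Fin N → Fin N → Fin N → ℝ}
    (hs : ∀ j k l, b j k l = b k j l) (hd : ∀ j k l, b j k l + b j l k = d j k l) (j k l : Fin N) :
    b j k l = (1 / 2) * (d j k l + d k j l - d l j k) := by
  have h1 := hd j k l
  have h2 := hd k j l
  have h3 := hd l j k
  rw [hs k j l] at h2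
  rw [hs l j k, hs l k j] at h3
  linarith

theorem pd_pseudoInner {s : ℕ} {V : Set (Coord N)} (hV : IsOpen V)
    {f f' : Coord N → EuclideanSpace ℝ (Fin m)} (hf : ContDiffOn ℝ ∞ f V)
    (hf' : ContDiffOn ℝ ∞ f' V) {x : Coord N} (hx : x ∈ V) (i : Fin N) :
    pd i (fun y => pseudoInner s (f y) (f' y)) x =
      pseudoInner s (pd i f x) (f' x) + pseudoInner s (f x) (pd i f' x) := by
  have hd : ∀ a, DifferentiableAt ℝ (fun y => f y a) x := fun a =>
    differentiableAt_of_contDiffOn hV (contDiffOn_euclidean.1 hf a) hx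
  have hd' : ∀ a, DifferentiableAt ℝ (fun y => f' y a) x := fun a =>
    differentiableAt_of_contDiffOn hV (contDiffOn_euclidean.1 hf' a) hx
  simp only [pseudoInner]
  rw [pd_sum fun a => ((hd a).const_mul _).fun_mul (hd' a), ← Finset.sum_add_distrib]
  refine Finset.sum_congr rfl fun a _ => ?_
  rw [pd_mul ((hd a).const_mul _) (hd' a), pd_const_mul (hd a),
    pd_coord (differentiableAt_of_contDiffOn hV hf hx),
    pd_coord (differentiableAt_of_contDiffOn hV hf' hx)]

/-- A frame of vector fields `E` (in rows) with Gram matrix `G` and `(∂ⱼE_a, E_b) = (Bⱼ)_{ab}` is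
determined by `G` and `B` up to a constant isometry. -/
theorem exists_isometry_of_frames {ι : Type*} [Fintype ι] [DecidableEq ι]
    (hm : Fintype.card ι = m) {V : Set (Coord N)} (hV : IsOpen V) (hc : IsConnected V) {s₁ s₂ : ℕ}
    (hs₁ : s₁ ≤ m) (hs₂ : s₂ ≤ m) {E₁ E₂ : Coord N → Matrix ι (Fin m) ℝ}
    {G : Coord N → Matrix ι ι ℝ} (hE₁ : SmoothMatOn E₁ V) (hE₂ : SmoothMatOn E₂ V)
    (hG : ∀ x ∈ V, (G x).det ≠ 0)
    (hG₁ : ∀ x ∈ V, E₁ x * signMat m s₁ * (E₁ x)ᵀ = G x)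
    (hG₂ : ∀ x ∈ V, E₂ x * signMat m s₂ * (E₂ x)ᵀ = G x)
    (hB : ∀ x ∈ V, ∀ j, pdM j E₁ x * signMat m s₁ * (E₁ x)ᵀ =
      pdM j E₂ x * signMat m s₂ * (E₂ x)ᵀ) :
    s₁ = s₂ ∧ ∃ A : Matrix (Fin m) (Fin m) ℝ, A * signMat m s₁ * Aᵀ = signMat m s₁ ∧
      ∀ x ∈ V, E₂ x = E₁ x * A := by
  have hcard : Fintype.card ι = Fintype.card (Fin m) := by simpa using hm
  have hGs : SmoothMatOn G V := ((hE₁.mul (.const _)).mul hE₁.transpose).congr fun x hx =>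
    (hG₁ x hx).symm
  -- `R₁`, `R₂` are the inverses of `E₁`, `E₂`
  let R₁ : Coord N → Matrix (Fin m) ι ℝ := fun x => signMat m s₁ * (E₁ x)ᵀ * (G x)⁻¹
  let R₂ : Coord N → Matrix (Fin m) ι ℝ := fun x => signMat m s₂ * (E₂ x)ᵀ * (G x)⁻¹
  have hR₁s : SmoothMatOn R₁ V := ((SmoothMatOn.const _).mul hE₁.transpose).mul (hGs.inv hG)
  have hGi : ∀ x ∈ V, G x * (G x)⁻¹ = 1 := fun x hx =>
    Matrix.mul_nonsing_inv _ (isUnit_iff_ne_zero.2 (hG x hx))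
  have hER₁ : ∀ x ∈ V, E₁ x * R₁ x = 1 := fun x hx => by
    simp only [R₁, ← Matrix.mul_assoc, hG₁ x hx, hGi x hx]
  have hER₂ : ∀ x ∈ V, E₂ x * R₂ x = 1 := fun x hx => by
    simp only [R₂, ← Matrix.mul_assoc, hG₂ x hx, hGi x hx]
  have hRE₁ : ∀ x ∈ V, R₁ x * E₁ x = 1 := fun x hx =>
    (Matrix.mul_eq_one_comm_of_card_eq _ _ _ hcard).1 (hER₁ x hx)
  have hRE₂ : ∀ x ∈ V, R₂ x * E₂ x = 1 := fun x hx =>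
    (Matrix.mul_eq_one_comm_of_card_eq _ _ _ hcard).1 (hER₂ x hx)
  obtain ⟨A, hA⟩ := exists_eq_const_of_pdM_eq_zero hV hc.isPreconnected (hR₁s.mul hE₂) (by
    intro x hx j
    rw [pdM_mul hV hR₁s hE₂ hx, pdM_of_mul_eq_one hV hE₁ hR₁s hRE₁ hER₁ hx]
    have h1 : pdM j E₁ x * R₁ x = pdM j E₂ x * R₂ x := by
      have := congrArg (· * (G x)⁻¹) (hB x hx j)
      simpa [R₁, R₂, Matrix.mul_assoc] using this
    calc -(R₁ x * pdM j E₁ x * R₁ x) * E₂ x + R₁ x * pdM j E₂ x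
        = -(R₁ x * (pdM j E₁ x * R₁ x) * E₂ x) + R₁ x * pdM j E₂ x := by
          rw [Matrix.neg_mul, Matrix.mul_assoc (R₁ x)]
      _ = -(R₁ x * pdM j E₂ x * (R₂ x * E₂ x)) + R₁ x * pdM j E₂ x := by
          rw [h1]
          simp only [Matrix.mul_assoc]
      _ = 0 := by rw [hRE₂ x hx, Matrix.mul_one, neg_add_cancel])
  have hEA : ∀ x ∈ V, E₂ x = E₁ x * A := fun x hx => by
    rw [← hA x hx, ← Matrix.mul_assoc, hER₁ x hx, Matrix.one_mul]
  have hiso : A * signMat m s₂ * Aᵀ = signMat m s₁ := by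
    obtain ⟨x, hx⟩ := hc.nonempty
    have h1 : E₁ x * (A * signMat m s₂ * Aᵀ) * (E₁ x)ᵀ = E₁ x * signMat m s₁ * (E₁ x)ᵀ := by
      rw [hG₁ x hx, ← hG₂ x hx, hEA x hx, Matrix.transpose_mul]
      simp only [Matrix.mul_assoc]
    have hER₁t : (E₁ x)ᵀ * (R₁ x)ᵀ = 1 := by
      rw [← Matrix.transpose_mul, hRE₁ x hx, Matrix.transpose_one]
    have h2 := congrArg (fun Z => R₁ x * Z * (R₁ x)ᵀ) h1
    simp only [← Matrix.mul_assoc, hRE₁ x hx, Matrix.one_mul] at h2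
    simpa only [Matrix.mul_assoc, hER₁t, Matrix.mul_one] using h2
  have hs := index_eq_of_isometry hs₁ hs₂ hiso
  subst hs
  exact ⟨rfl, A, hiso, hEA⟩

/-- The normals `N_i = ∑_α (∂ᵢu^α) ν_α` numbered by the coordinates `xⁱ`. -/
def coordNormal (u : Fin N → Coord N → ℝ) (ν : Fin N → Coord N → EuclideanSpace ℝ (Fin m))
    (i : Fin N) (x : Coord N) : EuclideanSpace ℝ (Fin m) :=
  ∑ α, pd i (u α) x • ν α x

/-- The frame `(∂ᵢr, N_i)`, in rows. -/
def coordFrame (r : Coord N → EuclideanSpace ℝ (Fin m)) (u : Fin N → Coord N → ℝ)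
    (ν : Fin N → Coord N → EuclideanSpace ℝ (Fin m)) (x : Coord N) :
    Matrix (Fin N ⊕ Fin N) (Fin m) ℝ :=
  Matrix.of (Sum.elim (fun i p => pd i r x p) fun i p => coordNormal u ν i x p)

theorem pseudoInner_sum_smul_left {s : ℕ} (a : Fin N → ℝ) (w : Fin N → EuclideanSpace ℝ (Fin m))
    (y : EuclideanSpace ℝ (Fin m)) :
    pseudoInner s (∑ α, a α • w α) y = ∑ α, a α * pseudoInner s (w α) y := by
  rw [pseudoInner_comm]
  refine ((map_sum (pseudoInnerLeft s y) _ _).trans ?_)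
  refine Finset.sum_congr rfl fun α _ => ?_
  rw [map_smul, smul_eq_mul, pseudoInner_comm]
  rfl

section Frame

variable {s : ℕ} {V : Set (Coord N)} {r : Coord N → EuclideanSpace ℝ (Fin m)}
  {ν : Fin N → Coord N → EuclideanSpace ℝ (Fin m)} {μ : Matrix (Fin N) (Fin N) ℝ}
  {u : Fin N → Coord N → ℝ} {x : Coord N}

theorem contDiffOn_coordNormal (hV : IsOpen V) (hν : ∀ α, ContDiffOn ℝ ∞ (ν α) V)
    (hu : ∀ α, ContDiffOn ℝ ∞ (u α) V) (i : Fin N) : ContDiffOn ℝ ∞ (coordNormal u ν i) V :=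
  ContDiffOn.sum fun α _ => (contDiffOn_pd hV (hu α) i).smul (hν α)

theorem pseudoInner_coordNormal_secondForms (i j k : Fin N) :
    pseudoInner s (coordNormal u ν i x) (pd j (pd k r) x) = secondForms s r ν u i j k x :=
  pseudoInner_sum_smul_left _ _ _

theorem pseudoInner_coordNormal_pd (hν : IsTorsionlessFrameOn s V r ν μ) (hx : x ∈ V)
    (i k : Fin N) : pseudoInner s (coordNormal u ν i x) (pd k r x) = 0 := by
  rw [coordNormal, pseudoInner_sum_smul_left]
  simp [hν.normal x hx]

theorem pseudoInner_coordNormal (hν : IsTorsionlessFrameOn s V r ν μ) (hx : x ∈ V)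
    (i k : Fin N) :
    pseudoInner s (coordNormal u ν i x) (coordNormal u ν k x) = normalGram μ u x i k := by
  rw [coordNormal, pseudoInner_sum_smul_left, normalGram, Matrix.of_apply]
  refine Finset.sum_congr rfl fun α _ => ?_
  rw [pseudoInner_comm, coordNormal, pseudoInner_sum_smul_left, Finset.mul_sum]
  refine Finset.sum_congr rfl fun β _ => ?_
  rw [pseudoInner_comm, hν.gram x hx]
  ring

/-- As the torsion vanishes, the components `(∂ⱼN_i, N_k)` are symmetric in `i` and `j`. -/
theorem pseudoInner_pd_coordNormal_symm (hV : IsOpen V) (hν : IsTorsionlessFrameOn s V r ν μ)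
    (hu : ∀ α, ContDiffOn ℝ ∞ (u α) V) (hx : x ∈ V) (j i k : Fin N) :
    pseudoInner s (pd j (coordNormal u ν i) x) (coordNormal u ν k x) =
      pseudoInner s (pd i (coordNormal u ν j) x) (coordNormal u ν k x) := by
  have key : ∀ j i, pseudoInner s (pd j (coordNormal u ν i) x) (coordNormal u ν k x) =
      ∑ α, pd j (pd i (u α)) x * pseudoInner s (ν α x) (coordNormal u ν k x) := by
    intro j i
    have hd : ∀ α, DifferentiableAt ℝ (pd i (u α)) x := fun α =>
      differentiableAt_of_contDiffOn hV (contDiffOn_pd hV (hu α) i) hx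
    have hdν : ∀ α, DifferentiableAt ℝ (ν α) x := fun α =>
      differentiableAt_of_contDiffOn hV (hν.smooth α) hx
    have h1 : pd j (coordNormal u ν i) x =
        ∑ α, pd j (pd i (u α)) x • ν α x + ∑ α, pd i (u α) x • pd j (ν α) x := by
      change pd j (fun y => ∑ α, pd i (u α) y • ν α y) x = _
      rw [pd_sum fun α => (hd α).fun_smul (hdν α), ← Finset.sum_add_distrib]
      refine Finset.sum_congr rfl fun α _ => ?_
      rw [pd, fderiv_fun_smul (hd α) (hdν α)]
      simp [pd, add_comm]
    have h2 : ∀ α, pseudoInner s (pd j (ν α) x) (coordNormal u ν k x) = 0 := by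
      intro α
      rw [pseudoInner_comm, coordNormal, pseudoInner_sum_smul_left]
      refine Finset.sum_eq_zero fun β _ => ?_
      rw [pseudoInner_comm, hν.torsion x hx, mul_zero]
    rw [h1, pseudoInner_comm]
    refine ((pseudoInnerLeft s (coordNormal u ν k x)).map_add _ _).trans ?_
    change pseudoInner s _ _ + pseudoInner s _ _ = _
    rw [pseudoInner_comm, pseudoInner_sum_smul_left, pseudoInner_comm, pseudoInner_sum_smul_left]
    simp [h2]
  rw [key, key]
  exact Finset.sum_congr rfl fun α _ => by rw [pd_comm hV (hu α) hx]

theorem smoothMatOn_coordFrame (hV : IsOpen V) (hr : ContDiffOn ℝ ∞ r V)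
    (hν : ∀ α, ContDiffOn ℝ ∞ (ν α) V) (hu : ∀ α, ContDiffOn ℝ ∞ (u α) V) :
    SmoothMatOn (coordFrame r u ν) V := by
  rintro (i | i) p
  · exact contDiffOn_euclidean.1 (contDiffOn_pd hV hr i) p
  · exact contDiffOn_euclidean.1 (contDiffOn_coordNormal hV hν hu i) p

theorem coordFrame_gram (hν : IsTorsionlessFrameOn s V r ν μ) (hx : x ∈ V) :
    coordFrame r u ν x * signMat m s * (coordFrame r u ν x)ᵀ =
      Matrix.fromBlocks (firstForm s r x) 0 0 (normalGram μ u x) := by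
  ext (i | i) (k | k) <;> rw [mul_signMat_mul_transpose_apply]
  · rfl
  · exact (pseudoInner_comm _ _).trans (pseudoInner_coordNormal_pd hν hx k i)
  · exact pseudoInner_coordNormal_pd hν hx i k
  · exact pseudoInner_coordNormal hν hx i k

/-- The components of the derivatives of the frame with respect to the frame, as functions of the
first fundamental form `g`, of the Gram matrix `h` of the normals and of the second fundamental
forms `w`. -/
def frameDeriv (g h : Coord N → Matrix (Fin N) (Fin N) ℝ) (w : Fin N → Fin N → Fin N → Coord N → ℝ)
    (j : Fin N) (x : Coord N) : Matrix (Fin N ⊕ Fin N) (Fin N ⊕ Fin N) ℝ :=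
  Matrix.fromBlocks
    (Matrix.of fun k l => (1 / 2 : ℝ) * (pd j (fun y => g y k l) x + pd k (fun y => g y j l) x -
      pd l (fun y => g y j k) x))
    (Matrix.of fun k i => w i j k x)
    (Matrix.of fun i k => -w i j k x)
    (Matrix.of fun k l => (1 / 2 : ℝ) * (pd j (fun y => h y k l) x + pd k (fun y => h y j l) x -
      pd l (fun y => h y j k) x))

/-- The derivational formulas of Gauss and Weingarten. -/
theorem pdM_coordFrame (hV : IsOpen V) (hr : ContDiffOn ℝ ∞ r V)
    (hν : IsTorsionlessFrameOn s V r ν μ) (hu : ∀ α, ContDiffOn ℝ ∞ (u α) V) (hx : x ∈ V)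
    (j : Fin N) :
    pdM j (coordFrame r u ν) x * signMat m s * (coordFrame r u ν x)ᵀ =
      frameDeriv (firstForm s r) (normalGram μ u) (secondForms s r ν u) j x := by
  have hN := contDiffOn_coordNormal hV hν.smooth hu
  have hrow₁ : ∀ i, WithLp.toLp 2 (pdM j (coordFrame r u ν) x (Sum.inl i)) = pd j (pd i r) x := by
    intro i
    ext p
    exact (pd_coord (differentiableAt_of_contDiffOn hV (contDiffOn_pd hV hr i) hx) j p).symm
  have hrow₂ : ∀ i, WithLp.toLp 2 (pdM j (coordFrame r u ν) x (Sum.inr i)) =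
      pd j (coordNormal u ν i) x := by
    intro i
    ext p
    exact (pd_coord (differentiableAt_of_contDiffOn hV (hN i) hx) j p).symm
  ext (i | i) (k | k) <;> rw [mul_signMat_mul_transpose_apply]
  · rw [hrow₁]
    refine eq_half_sum_of_symm (b := fun j i k => pseudoInner s (pd j (pd i r) x) (pd k r x))
      (d := fun j i k => pd j (fun y => firstForm s r y i k) x) (fun j i k => ?_)
      (fun j i k => ?_) j i k
    · simp only [pd_comm hV hr hx j i]
    · have := pd_pseudoInner (s := s) hV (contDiffOn_pd hV hr i) (contDiffOn_pd hV hr k) hx j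
      refine Eq.trans ?_ this.symm
      rw [pseudoInner_comm (pd i r x)]
  · rw [hrow₁, pseudoInner_comm]
    exact pseudoInner_coordNormal_secondForms k j i
  · rw [hrow₂]
    have h1 := pd_pseudoInner (s := s) hV (hN i) (contDiffOn_pd hV hr k) hx j
    rw [pd_congr hV (fun y hy => pseudoInner_coordNormal_pd hν hy i k) hx, pd_const,
      pseudoInner_coordNormal_secondForms] at h1
    exact eq_neg_of_add_eq_zero_left h1.symm
  · rw [hrow₂]
    refine eq_half_sum_of_symm
      (b := fun j i k => pseudoInner s (pd j (coordNormal u ν i) x) (coordNormal u ν k x))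
      (d := fun j i k => pd j (fun y => normalGram μ u y i k) x) (fun j i k => ?_)
      (fun j i k => ?_) j i k
    · exact pseudoInner_pd_coordNormal_symm hV hν hu hx j i k
    · have := pd_pseudoInner (s := s) hV (hN i) (hN k) hx j
      rw [pd_congr hV (fun y hy => pseudoInner_coordNormal hν hy i k) hx] at this
      refine Eq.trans ?_ this.symm
      rw [pseudoInner_comm (coordNormal u ν i x)]

end Frame

/-- The uniqueness part of Bonnet's theorem: a submanifold with torsionless normals is determined up to a motion
by the first and second fundamental forms and the Gram matrix of the normals. -/
theorem exists_motion {V : Set (Coord N)} (hV : IsOpen V) (hc : IsConnected V) {s₁ s₂ : ℕ}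
    (hs₁ : s₁ ≤ 2 * N) (hs₂ : s₂ ≤ 2 * N) {r₁ r₂ : Coord N → EuclideanSpace ℝ (Fin (2 * N))}
    {ν₁ ν₂ : Fin N → Coord N → EuclideanSpace ℝ (Fin (2 * N))}
    {u₁ u₂ : Fin N → Coord N → ℝ} {η₁ η₂ μ₁ μ₂ : Matrix (Fin N) (Fin N) ℝ}
    (h₁ : IsPotentialFlatTorsionlessOn s₁ V r₁ ν₁ μ₁ u₁ η₁)
    (h₂ : IsPotentialFlatTorsionlessOn s₂ V r₂ ν₂ μ₂ u₂ η₂)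
    (hg : ∀ x ∈ V, firstForm s₁ r₁ x = firstForm s₂ r₂ x)
    (hw : ∀ x ∈ V, ∀ i j k, secondForms s₁ r₁ ν₁ u₁ i j k x = secondForms s₂ r₂ ν₂ u₂ i j k x)
    (hμ : ∀ x ∈ V, normalGram μ₁ u₁ x = normalGram μ₂ u₂ x) :
    s₁ = s₂ ∧ ∃ T : EuclideanSpace ℝ (Fin (2 * N)) → EuclideanSpace ℝ (Fin (2 * N)),
      IsMotion s₁ T ∧ ∀ x ∈ V, r₂ x = T (r₁ x) := by
  have hdet : ∀ x ∈ V,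
      (Matrix.fromBlocks (firstForm s₁ r₁ x) 0 0 (normalGram μ₁ u₁ x)).det ≠ 0 := by
    intro x hx
    rw [Matrix.det_fromBlocks_zero₂₁]
    refine mul_ne_zero (h₁.submanifold.nonisotropic x hx) ?_
    have : normalGram μ₁ u₁ x = (jacMat u₁ x)ᵀ * μ₁ * jacMat u₁ x := by
      ext i j
      simp only [normalGram, Matrix.of_apply, Matrix.mul_apply, Matrix.transpose_apply,
        jacMat_apply, Finset.sum_mul]
      rw [Finset.sum_comm]
      exact Finset.sum_congr rfl fun α _ => Finset.sum_congr rfl fun β _ => by ring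
    rw [this, Matrix.det_mul, Matrix.det_mul, Matrix.det_transpose]
    have hJ : (jacMat u₁ x).det ≠ 0 := h₁.flatCoord.jacobian x hx
    exact mul_ne_zero (mul_ne_zero hJ h₁.torsionless.gram_det) hJ
  have hr₁ := h₁.submanifold.smooth
  have hr₂ := h₂.submanifold.smooth
  obtain ⟨hs, A, hA, hE⟩ := exists_isometry_of_frames (by simp [two_mul]) hV hc hs₁ hs₂
    (smoothMatOn_coordFrame hV hr₁ h₁.torsionless.smooth h₁.flatCoord.smooth)
    (smoothMatOn_coordFrame hV hr₂ h₂.torsionless.smooth h₂.flatCoord.smooth) hdet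
    (fun x hx => coordFrame_gram h₁.torsionless hx)
    (fun x hx => by rw [coordFrame_gram h₂.torsionless hx, hg x hx, hμ x hx])
    (fun x hx j => by
      rw [pdM_coordFrame hV hr₁ h₁.torsionless h₁.flatCoord.smooth hx,
        pdM_coordFrame hV hr₂ h₂.torsionless h₂.flatCoord.smooth hx]
      have e1 : ∀ j k l, pd j (fun y => firstForm s₁ r₁ y k l) x =
          pd j (fun y => firstForm s₂ r₂ y k l) x := fun j k l =>
        pd_congr hV (fun y hy => by rw [hg y hy]) hx j
      have e2 : ∀ j k l, pd j (fun y => normalGram μ₁ u₁ y k l) x =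
          pd j (fun y => normalGram μ₂ u₂ y k l) x := fun j k l =>
        pd_congr hV (fun y hy => by rw [hμ y hy]) hx j
      simp only [frameDeriv, e1, e2, hw x hx])
  refine ⟨hs, ?_⟩
  let L : EuclideanSpace ℝ (Fin (2 * N)) →ₗ[ℝ] EuclideanSpace ℝ (Fin (2 * N)) :=
    Matrix.toEuclideanLin Aᵀ
  have hL : ∀ v, L v = WithLp.toLp 2 (((fun p => v p) : Fin (2 * N) → ℝ) ᵥ* A) := fun v => by
    rw [← Matrix.mulVec_transpose]
    rfl
  obtain ⟨b, hb⟩ := exists_eq_const_of_pd_eq_zero hV hc.isPreconnected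
    (f := fun x => r₂ x - LinearMap.toContinuousLinearMap L (r₁ x))
    (hr₂.sub ((LinearMap.toContinuousLinearMap L).contDiff.comp_contDiffOn hr₁)) (by
      intro x hx i
      have hd := (differentiableAt_of_contDiffOn hV hr₁ hx).hasFDerivAt
      have h1 := (LinearMap.toContinuousLinearMap L).hasFDerivAt.comp x hd
      rw [pd_sub (f' := fun y => LinearMap.toContinuousLinearMap L (r₁ y))
        (differentiableAt_of_contDiffOn hV hr₂ hx) h1.differentiableAt]
      have h2 : pd i (fun y => LinearMap.toContinuousLinearMap L (r₁ y)) x = L (pd i r₁ x) := by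
        change fderiv ℝ (LinearMap.toContinuousLinearMap L ∘ r₁) x (basisVec i) = _
        rw [h1.fderiv]
        rfl
      rw [h2, hL, sub_eq_zero]
      ext p
      exact congrFun (congrFun (hE x hx) (Sum.inl i)) p)
  refine ⟨fun v => L v + b, ⟨L, b, fun v w => ?_, fun _ => rfl⟩, fun x hx => ?_⟩
  · have h1 : ∀ v w : EuclideanSpace ℝ (Fin (2 * N)), pseudoInner s₁ v w =
        ((Matrix.of fun (_ : Unit) p => v p) * signMat (2 * N) s₁ *
          (Matrix.of fun (_ : Unit) p => w p)ᵀ) () () := fun v w => by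
      rw [mul_signMat_mul_transpose_apply]
      rfl
    have h2 : ∀ v : EuclideanSpace ℝ (Fin (2 * N)), (Matrix.of fun (_ : Unit) p => L v p) =
        (Matrix.of fun (_ : Unit) p => v p) * A := fun v => by
      rw [hL]
      rfl
    rw [h1, h1, h2, h2, Matrix.transpose_mul]
    conv_rhs => rw [← hA]
    simp only [Matrix.mul_assoc]
  · have := hb x hx
    change r₂ x - L (r₁ x) = b at this
    change r₂ x = L (r₁ x) + b
    rw [← this]
    abel

end Uniqueness

/-! ### Frobenius manifolds in charts -/

section Charts

open Matrix Metric

variable {N : ℕ}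

/-- A Frobenius structure on an open set has flat coordinates near every point `x₀`. They are
normalized so that their differentials at `x₀` are those of the given coordinates; the metric in the
flat coordinates is then `g x₀`. -/
theorem exists_isFlatFrobeniusOn {U : Set (Coord N)} (hU : IsOpen U)
    {g : Coord N → Matrix (Fin N) (Fin N) ℝ} {c : Fin N → Fin N → Fin N → Coord N → ℝ}
    (hg : SmoothMatOn g U) (hsymm : ∀ x ∈ U, (g x)ᵀ = g x) (hdet : ∀ x ∈ U, (g x).det ≠ 0)
    (hflat : IsFlatOn g U) (hc : ∀ i, SmoothMatOn (mulMat c i) U)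
    (hct : ∀ x ∈ U, ∀ i, (mulMat c i x)ᵀ = mulMat c i x)
    (hcs : ∀ x ∈ U, ∀ i j k, c i j k x = c j i k x)
    (hassoc : ∀ x ∈ U, ∀ i j, mulMat c i x * (g x)⁻¹ * mulMat c j x =
      mulMat c j x * (g x)⁻¹ * mulMat c i x)
    (hpot : ∀ x ∈ U, ∀ l i j k, covDeriv₃ g c l i j k x = covDeriv₃ g c i l j k x)
    {x₀ : Coord N} (hx₀ : x₀ ∈ U) :
    ∃ ρ > 0, ball x₀ ρ ⊆ U ∧ ∃ u, IsFlatFrobeniusOn (ball x₀ ρ) g c u (g x₀) := by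
  obtain ⟨ρ, hρ, hB, u, hus, hu0, hu⟩ := exists_flat_coordinates hU hg hsymm hdet hflat hx₀
  have hJs : SmoothMatOn (jacMat u) (ball x₀ ρ) := fun α i => contDiffOn_pd isOpen_ball (hus α) i
  have hKs := hJs.inv fun x hx => (hu x hx).1
  have hJK : ∀ x ∈ ball x₀ ρ, jacMat u x * (jacMat u x)⁻¹ = 1 := fun x hx =>
    Matrix.mul_nonsing_inv _ (isUnit_iff_ne_zero.2 (hu x hx).1)
  have hKJ : ∀ x ∈ ball x₀ ρ, (jacMat u x)⁻¹ * jacMat u x = 1 := fun x hx =>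
    Matrix.nonsing_inv_mul _ (isUnit_iff_ne_zero.2 (hu x hx).1)
  have hgs := hg.mono hB
  -- the components of the metric in the coordinates `u` are constant
  obtain ⟨T, hT⟩ := exists_eq_const_of_pdM_eq_zero isOpen_ball (convex_ball x₀ ρ).isPreconnected
    ((hKs.transpose.mul hgs).mul hKs) (by
      intro x hx i
      rw [pdM_mul isOpen_ball (hKs.transpose.mul hgs) hKs hx, pdM_mul isOpen_ball hKs.transpose hgs hx,
        pdM_transpose, pdM_of_mul_eq_one isOpen_ball hJs hKs hKJ hJK hx, (hu x hx).2,
        pdM_metric hU hsymm hdet (hB hx), ← Matrix.mul_assoc, hKJ x hx, Matrix.one_mul,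
        Matrix.transpose_neg, Matrix.transpose_mul]
      noncomm_ring)
  have hTg : T = g x₀ := by
    rw [← hT x₀ (mem_ball_self hρ), hu0]
    simp
  refine ⟨ρ, hρ, hB, u, ?_⟩
  exact
    { isOpen := isOpen_ball
      convex := convex_ball x₀ ρ
      smooth_conn := fun l => (smoothMatOn_connMat hU hg hdet l).mono hB
      conn_symm := fun x hx => christoffel_symm hU hsymm (hB hx)
      smooth_mul := fun i => (hc i).mono hB
      mul_symm := fun x hx => hct x (hB hx)
      mul_swap := fun x hx => hcs x (hB hx)
      assoc := fun x hx => hassoc x (hB hx)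
      potential := fun x hx => hpot x (hB hx)
      smooth_coord := hus
      jac_det := fun x hx => (hu x hx).1
      pdM_jac := fun x hx => (hu x hx).2
      metric_symm := hsymm x₀ hx₀
      metric_det := hdet x₀ hx₀
      metric_eq := fun x hx => by
        rw [← hTg, ← hT x hx]
        have hJtKt : (jacMat u x)ᵀ * ((jacMat u x)⁻¹)ᵀ = 1 := by
          rw [← Matrix.transpose_mul, hKJ x hx, Matrix.transpose_one]
        simp only [← Matrix.mul_assoc, hJtKt, Matrix.one_mul]
        rw [Matrix.mul_assoc, hKJ x hx, Matrix.mul_one] }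

section Basis

variable {E : Type*} [AddCommGroup E] [Module ℝ E] (b : Module.Basis (Fin N) ℝ E)
  {B : E →ₗ[ℝ] E →ₗ[ℝ] ℝ} {G : Matrix (Fin N) (Fin N) ℝ}

theorem form_apply_basis (hG : ∀ i j, G i j = B (b i) (b j)) (X : E) (j : Fin N) :
    B X (b j) = ∑ i, b.repr X i * G i j := by
  conv_lhs => rw [← b.sum_repr X, map_sum, LinearMap.sum_apply]
  refine Finset.sum_congr rfl fun i _ => ?_
  rw [map_smul, LinearMap.smul_apply, smul_eq_mul, hG]

theorem repr_eq_sum_inv (hG : ∀ i j, G i j = B (b i) (b j)) (hs : Gᵀ = G) (hdet : G.det ≠ 0) (X : E)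
    (k : Fin N) : b.repr X k = ∑ l, G⁻¹ k l * B X (b l) := by
  have h1 : (fun l => B X (b l)) = G *ᵥ (b.repr X) := by
    ext l
    rw [form_apply_basis b hG, Matrix.mulVec, dotProduct]
    exact Finset.sum_congr rfl fun i _ => by
      rw [← congrFun (congrFun hs l) i, Matrix.transpose_apply, mul_comm]
  have h2 : G⁻¹ *ᵥ (fun l => B X (b l)) = b.repr X := by
    rw [h1, Matrix.mulVec_mulVec, Matrix.nonsing_inv_mul _ (isUnit_iff_ne_zero.2 hdet),
      Matrix.one_mulVec]
  exact (congrFun h2 k).symm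

theorem eq_sum_inv_smul (hG : ∀ i j, G i j = B (b i) (b j)) (hs : Gᵀ = G) (hdet : G.det ≠ 0)
    (X : E) : X = ∑ k, (∑ l, G⁻¹ k l * B X (b l)) • b k := by
  conv_lhs => rw [← b.sum_repr X]
  simp only [repr_eq_sum_inv b hG hs hdet]

theorem form_eq_sum_inv (hG : ∀ i j, G i j = B (b i) (b j)) (hs : Gᵀ = G) (hdet : G.det ≠ 0)
    (X Y : E) : B Y X = ∑ k, (∑ l, G⁻¹ k l * B X (b l)) * B Y (b k) := by
  conv_lhs => rw [eq_sum_inv_smul b hG hs hdet X]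
  simp

theorem det_ne_zero_of_nondegenerate (hG : ∀ i j, G i j = B (b i) (b j))
    (hB : ∀ X, (∀ Y, B X Y = 0) → X = 0) : G.det ≠ 0 := by
  intro h0
  obtain ⟨v, hv, hv0⟩ := Matrix.exists_vecMul_eq_zero_iff.2 h0
  have hX : ∑ i, v i • b i = 0 := by
    refine hB _ fun Y => ?_
    have : B (∑ i, v i • b i) = 0 := by
      refine b.ext fun j => ?_
      have := congrFun hv0 j
      simpa [Matrix.vecMul, dotProduct, hG] using this
    rw [this, LinearMap.zero_apply]
  exact hv (funext fun i => Fintype.linearIndependent_iff.1 b.linearIndependent v hX i)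

end Basis

variable {M : Type*} [TopologicalSpace M] [ChartedSpace (Coord N) M]

/-- The coordinate vector fields of a chart form a basis of the tangent space. -/
theorem exists_basis_coordVec {χ : OpenPartialHomeomorph M (Coord N)}
    (hχ : χ ∈ IsManifold.maximalAtlas (𝓡 N) ∞ M) {x : Coord N} (hx : x ∈ χ.target) :
    ∃ b : Module.Basis (Fin N) ℝ (TangentSpace (𝓡 N) (χ.symm x)), ∀ i, b i = coordVec χ i x := by
  have hd : χ.MDifferentiable (𝓡 N) (𝓡 N) :=
    ⟨(contMDiffOn_of_mem_maximalAtlas hχ).mdifferentiableOn (by simp),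
      (contMDiffOn_symm_of_mem_maximalAtlas hχ).mdifferentiableOn (by simp)⟩
  let e := hd.symm.mfderiv (x := x) hx
  let b : Module.Basis (Fin N) ℝ (TangentSpace (𝓡 N) x) :=
    (EuclideanSpace.basisFun (Fin N) ℝ).toBasis
  have hb : ∀ i, b i = basisVec i := fun i => by
    change (EuclideanSpace.basisFun (Fin N) ℝ).toBasis i = _
    rw [OrthonormalBasis.coe_toBasis, EuclideanSpace.basisFun_apply, basisVec]
  refine ⟨b.map e.toLinearEquiv, fun i => ?_⟩
  rw [Module.Basis.map_apply, hb]
  rfl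

variable [IsManifold (𝓡 N) ∞ M] (F : FrobeniusManifold N M) {χ : OpenPartialHomeomorph M (Coord N)}

theorem metricInChart_transpose (x : Coord N) :
    (metricInChart F.metric χ x)ᵀ = metricInChart F.metric χ x := by
  ext i j
  exact F.metric_symm _ _ _

theorem metricInChart_det_ne_zero (hχ : χ ∈ IsManifold.maximalAtlas (𝓡 N) ∞ M) {x : Coord N}
    (hx : x ∈ χ.target) : (metricInChart F.metric χ x).det ≠ 0 := by
  obtain ⟨b, hb⟩ := exists_basis_coordVec hχ hx
  refine det_ne_zero_of_nondegenerate b (B := F.metric (χ.symm x)) (fun i j => ?_)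
    (F.metric_nondegenerate _)
  rw [hb, hb]
  rfl

theorem mulInChart_swap (i j k : Fin N) (x : Coord N) :
    mulInChart F.metric F.mul χ i j k x = mulInChart F.metric F.mul χ j i k x := by
  rw [mulInChart, F.mul_comm, mulInChart]

theorem mulMat_mulInChart_transpose (i : Fin N) (x : Coord N) :
    (mulMat (mulInChart F.metric F.mul χ) i x)ᵀ = mulMat (mulInChart F.metric F.mul χ) i x := by
  ext j k
  simp only [Matrix.transpose_apply, mulMat_apply, mulInChart]
  rw [F.mul_comm, F.invariant, F.metric_symm]

/-- A tangent vector in terms of its lowered components. -/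
theorem eq_sum_inv_smul_coordVec (hχ : χ ∈ IsManifold.maximalAtlas (𝓡 N) ∞ M) {x : Coord N}
    (hx : x ∈ χ.target) (X : TangentSpace (𝓡 N) (χ.symm x)) :
    X = ∑ k, (∑ l, (metricInChart F.metric χ x)⁻¹ k l * F.metric _ X (coordVec χ l x)) •
      coordVec χ k x := by
  obtain ⟨b, hb⟩ := exists_basis_coordVec hχ hx
  simp only [← hb]
  exact eq_sum_inv_smul b (fun i j => by rw [hb, hb]; rfl) (metricInChart_transpose F x)
    (metricInChart_det_ne_zero F hχ hx) X

theorem mulInChart_assoc (hχ : χ ∈ IsManifold.maximalAtlas (𝓡 N) ∞ M) {x : Coord N}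
    (hx : x ∈ χ.target) (i j : Fin N) :
    mulMat (mulInChart F.metric F.mul χ) i x * (metricInChart F.metric χ x)⁻¹ *
        mulMat (mulInChart F.metric F.mul χ) j x =
      mulMat (mulInChart F.metric F.mul χ) j x * (metricInChart F.metric χ x)⁻¹ *
        mulMat (mulInChart F.metric F.mul χ) i x := by
  obtain ⟨b, hb⟩ := exists_basis_coordVec hχ hx
  have key : ∀ i j p q, (mulMat (mulInChart F.metric F.mul χ) i x *
      (metricInChart F.metric χ x)⁻¹ * mulMat (mulInChart F.metric F.mul χ) j x) p q =
      F.metric _ (F.mul _ (F.mul _ (coordVec χ i x) (coordVec χ p x)) (coordVec χ j x))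
        (coordVec χ q x) := by
    intro i j p q
    rw [F.invariant, form_eq_sum_inv b (B := F.metric (χ.symm x)) (fun i j => by rw [hb, hb]; rfl)
      (metricInChart_transpose F x) (metricInChart_det_ne_zero F hχ hx), Matrix.mul_assoc,
      Matrix.mul_apply]
    refine Finset.sum_congr rfl fun k _ => ?_
    rw [Matrix.mul_apply, mul_comm, hb, mulMat_apply]
    congr 1
    refine Finset.sum_congr rfl fun l _ => ?_
    rw [hb, ← mulMat_mulInChart_transpose F j x]
    rfl
  ext p q
  rw [key, key, F.mul_comm _ (coordVec χ i x) (coordVec χ p x),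
    F.mul_comm _ (coordVec χ j x) (coordVec χ p x), F.mul_assoc, F.mul_assoc,
    F.mul_comm _ (coordVec χ i x) (coordVec χ j x)]

/-- The Frobenius structure in a chart of the atlas has flat coordinates near every point. -/
theorem exists_isFlatFrobeniusOn_chart (hχ : χ ∈ atlas (Coord N) M) {x₀ : Coord N}
    (hx₀ : x₀ ∈ χ.target) :
    ∃ ρ > 0, ball x₀ ρ ⊆ χ.target ∧ ∃ u η, IsFlatFrobeniusOn (ball x₀ ρ)
      (metricInChart F.metric χ) (mulInChart F.metric F.mul χ) u η := by
  have hχ' : χ ∈ IsManifold.maximalAtlas (𝓡 N) ∞ M := IsManifold.subset_maximalAtlas hχ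
  obtain ⟨ρ, hρ, hB, u, hu⟩ := exists_isFlatFrobeniusOn χ.open_target
    (fun i j => F.metric_smooth χ hχ i j) (fun x _ => metricInChart_transpose F x)
    (fun x hx => metricInChart_det_ne_zero F hχ' hx) (F.flat χ hχ)
    (fun i j k => F.mul_smooth χ hχ i j k) (fun x _ i => mulMat_mulInChart_transpose F i x)
    (fun x _ i j k => mulInChart_swap F i j k x) (fun x hx => mulInChart_assoc F hχ' hx)
    (F.potential χ hχ) hx₀
  exact ⟨ρ, hρ, hB, u, _, hu⟩

/-- A chart can be restricted to the preimage of a ball in its target. -/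
theorem exists_restricted_chart (hχ : χ ∈ IsManifold.maximalAtlas (𝓡 N) ∞ M) {x₀ : Coord N} {ρ : ℝ}
    (hB : ball x₀ ρ ⊆ χ.target) :
    ∃ χ' ∈ IsManifold.maximalAtlas (𝓡 N) ∞ M, χ'.target = ball x₀ ρ ∧
      (∀ p ∈ χ.source, χ p ∈ ball x₀ ρ → p ∈ χ'.source) ∧
      (∀ x, metricInChart F.metric χ' x = metricInChart F.metric χ x) ∧
      (∀ i j k x, mulInChart F.metric F.mul χ' i j k x = mulInChart F.metric F.mul χ i j k x) := by
  have hs : IsOpen (χ.source ∩ χ ⁻¹' ball x₀ ρ) := χ.isOpen_inter_preimage isOpen_ball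
  refine ⟨χ.restr (χ.source ∩ χ ⁻¹' ball x₀ ρ), restr_mem_maximalAtlas _ hχ hs, ?_, ?_,
    fun _ => rfl, fun _ _ _ _ => rfl⟩
  · ext x
    simp only [OpenPartialHomeomorph.restr_target, hs.interior_eq, Set.mem_inter_iff,
      Set.mem_preimage]
    constructor
    · rintro ⟨hx, -, hx'⟩
      rwa [χ.right_inv hx] at hx'
    · intro hx
      exact ⟨hB hx, χ.map_target (hB hx), by rwa [χ.right_inv (hB hx)]⟩
  · intro p hp hp'
    rw [χ.restr_source' _ hs]
    exact ⟨hp, hp, hp'⟩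

end Charts

end FrobeniusSubmanifold

end

open FrobeniusSubmanifold in
theorem theorem7 {N : ℕ} {M : Type*} [TopologicalSpace M] [ChartedSpace (Coord N) M]
    [IsManifold (𝓡 N) ∞ M] (F : FrobeniusManifold N M) :
    -- local existence, with normals of Gram matrix `κ η` for any prescribed nonzero constant `κ`
    (∀ κ : ℝ, κ ≠ 0 → ∀ p : M, ∃ χ ∈ IsManifold.maximalAtlas (𝓡 N) ∞ M,
      p ∈ χ.source ∧ IsConnected χ.target ∧
      ∃ s ≤ 2 * N, ∃ (r : Coord N → EuclideanSpace ℝ (Fin (2 * N)))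
        (ν : Fin N → Coord N → EuclideanSpace ℝ (Fin (2 * N)))
        (u : Fin N → Coord N → ℝ) (η : Matrix (Fin N) (Fin N) ℝ),
        F.IsRepresentedBy χ s r ν (κ • η) u η ∧
          Set.InjOn (fun x α => u α x) χ.target ∧
          Topology.IsEmbedding (χ.target.domRestrict r)) ∧
    -- uniqueness up to motions, for a given Gram matrix of the normals
    (∀ χ ∈ IsManifold.maximalAtlas (𝓡 N) ∞ M, IsConnected χ.target →
      ∀ s₁ ≤ 2 * N, ∀ s₂ ≤ 2 * N, ∀ (r₁ r₂ : Coord N → EuclideanSpace ℝ (Fin (2 * N)))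
        (ν₁ ν₂ : Fin N → Coord N → EuclideanSpace ℝ (Fin (2 * N)))
        (u₁ u₂ : Fin N → Coord N → ℝ) (η₁ η₂ μ₁ μ₂ : Matrix (Fin N) (Fin N) ℝ),
        F.IsRepresentedBy χ s₁ r₁ ν₁ μ₁ u₁ η₁ → F.IsRepresentedBy χ s₂ r₂ ν₂ μ₂ u₂ η₂ →
        (∀ x ∈ χ.target, normalGram μ₁ u₁ x = normalGram μ₂ u₂ x) →
          s₁ = s₂ ∧ ∃ T : EuclideanSpace ℝ (Fin (2 * N)) → EuclideanSpace ℝ (Fin (2 * N)),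
            IsMotion s₁ T ∧ ∀ x ∈ χ.target, r₂ x = T (r₁ x)) := by
  refine ⟨fun κ hκ p => ?_, fun χ hχ hconn s₁ hs₁ s₂ hs₂ r₁ r₂ ν₁ ν₂ u₁ u₂ η₁ η₂ μ₁ μ₂ h₁ h₂ hμ => ?_⟩
  · let χ₀ := chartAt (Coord N) p
    have hχ₀ : χ₀ ∈ atlas (Coord N) M := chart_mem_atlas _ p
    obtain ⟨ρ₁, hρ₁, hB₁, u, η, hF⟩ := exists_isFlatFrobeniusOn_chart F hχ₀ (x₀ := χ₀ p)
      (χ₀.map_source (mem_chart_source _ p))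
    obtain ⟨s, hs, ρ, hρ, hB, r, ν, hsub, hg, hw, hinj, hemb⟩ := hF.exists_submanifold
      (fun x hx => F.flat χ₀ hχ₀ x (hB₁ hx)) hκ (Metric.mem_ball_self hρ₁)
    obtain ⟨χ, hχ, hχt, hχs, hχg, hχc⟩ := exists_restricted_chart F
      (IsManifold.subset_maximalAtlas (I := 𝓡 N) (n := ∞) hχ₀) (hB.trans hB₁)
    refine ⟨χ, hχ, hχs p (mem_chart_source _ p) (Metric.mem_ball_self hρ), ?_, s, hs, r, ν, u, η,
      ⟨by rwa [hχt], fun x hx => ?_, fun x hx i j => ?_⟩, by rwa [hχt], by rwa [hχt]⟩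
    · rw [hχt]
      exact (convex_ball _ _).isConnected ⟨_, Metric.mem_ball_self hρ⟩
    · rw [hχg]
      exact hg x (hχt ▸ hx)
    · refine (eq_sum_inv_smul_coordVec F hχ hx _).trans ?_
      have hx' : x ∈ Metric.ball (χ₀ p) ρ := hχt ▸ hx
      refine Finset.sum_congr rfl fun k _ => ?_
      congr 1
      refine Finset.sum_congr rfl fun l _ => ?_
      rw [hχg, hg x hx', hw x hx', ← hχc]
      congr 1
      exact congrFun (congrFun (mulMat_mulInChart_transpose F (χ := χ) i x) l) j
  · refine exists_motion χ.open_target hconn hs₁ hs₂ h₁.potentialSubmanifold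
      h₂.potentialSubmanifold (fun x hx => (h₁.firstForm_eq x hx).trans (h₂.firstForm_eq x hx).symm)
      (fun x hx i j k => ?_) hμ
    obtain ⟨b, hb⟩ := exists_basis_coordVec hχ hx
    have hdet := metricInChart_det_ne_zero F hχ hx
    have h := (h₁.mul_eq x hx i k).symm.trans (h₂.mul_eq x hx i k)
    rw [h₁.firstForm_eq x hx, h₂.firstForm_eq x hx] at h
    simp only [← hb] at h
    have h' := fun a => congrArg (fun X => b.repr X a) h
    simp only [map_sum, map_smul, Finsupp.coe_finsetSum, Finset.sum_apply, Finsupp.smul_apply,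
      Module.Basis.repr_self, Finsupp.single_apply, smul_eq_mul, mul_ite, mul_one, mul_zero,
      Finset.sum_ite_eq', Finset.mem_univ, if_true] at h'
    have hinv : Function.Injective ((metricInChart F.metric χ x)⁻¹.mulVec) :=
      Matrix.mulVec_injective_iff_isUnit.2 ((Matrix.isUnit_nonsing_inv_iff).2
        ((Matrix.isUnit_iff_isUnit_det _).2 (isUnit_iff_ne_zero.2 hdet)))
    have hv := hinv (a₁ := fun l => secondForms s₁ r₁ ν₁ u₁ i l k x)
      (a₂ := fun l => secondForms s₂ r₂ ν₂ u₂ i l k x) (funext h')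
    exact congrFun hv j
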